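/- Let $n\ge 3$, $n\neq 4$, let $q\in\mathbb C$ be a primitive $n$-th root of unity, and put $d=n$ if $n$ is odd, $d=n/2$ if $n$ is even. Let $\mathrm u_q$ be the complex algebra with generators $E,F,K$ and relations $E^d=F^d=0$, $K^d=1$, $KE=q^2EK$, $KF=q^{-2}FK$, $EF-FE=\frac{K-K^{-1}}{q-q^{-1}}$; it acts on tensor products over $\mathbb C$ through the comultiplication $\Delta(E)=1\otimes E+E\otimes K$, $\Delta(F)=K^{-1}\otimes F+F\otimes 1$, $\Delta(K)=K\otimes K$. For $m\in\mathbb Z$ let $[m]=\frac{q^m-q^{-m}}{q-q^{-1}}$ and let $\overline m\in\{0,\dots,d-1\}$ be the residue of $m$ modulo $d$; for $i\in\mathbb Z/d\mathbb Z$ and $j\ge 0$ put $\lambda_i^{j-1}=-\sum_{0\le h<j}[2(i+h)]$ (so $\lambda_i^{-1}=0$). For $i\in\mathbb Z/d\mathbb Z$ and $0\le u\le d-1$ with $u\equiv-2i \pmod d$, let $\overline M_i^u$ be the simple $\mathrm u_q$-module with basis $e_i^0,\dots,e_i^u$ and action $Ke_i^j=q^{2(i+j)}e_i^j$, $Ee_i^j=e_i^{j+1}$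 (with $e_i^{u+1}=0$), $Fe_i^j=\lambda_i^{j-1}e_i^{j-1}$ (so $Fe_i^0=0$). For $k\in\mathbb Z/d\mathbb Z$ let $P_k$ have basis $e_k^0,\dots,e_k^{d-1}$, with $Ke_k^j=q^{2(k+j)}e_k^j$ and $Ee_k^j=e_k^{j+1}$, where $e_k^m=0$ for $m\ge d$. If $2k\not\equiv1\pmod d$, let $\tilde P_k$ be the $2d$-dimensional $\mathrm u_q$-module $P_k\oplus P_{1-k}$ with $E$ and $K$ acting as above and $$Fe_k^j=\lambda_k^{j-1}e_k^{j-1},\qquad Fe_{1-k}^j=e_k^{\overline{-2k}+j}+\lambda_{1-k}^{j-1}e_{1-k}^{j-1}\qquad(0\le j\le d-1).$$ If $2k\equiv1\pmod d$, let $\tilde P_k$ be the $d$-dimensional $\mathrm u_q$-module $P_k$ with $Fe_k^j=\lambda_k^{j-1}e_k^{j-1}$. **Theorem 5.2.** Let $i,j\in\mathbb Z/d\mathbb Z$ and $0\le u,v\le d-1$ with $u\equiv-2i$ and $v\equiv-2j\pmod d$, suppose $u+v\ge d-1$, and set $e=u+v-(d-1)$. Then there is an isomorphism of $\mathrm u_q$-modules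 $$\overline M_i^u\otimes\overline M_j^v\;\cong\;\bigoplus_{l=0}^{\lfloor e/2\rfloor}\tilde P_{i+j+l}\;\oplus\;\bigoplus_{l=e+1}^{\min(u,v)}\overline M_{i+j+l}^{u+v-2l},$$ and the modules $\tilde P_{i+j+l}$, $0\le l\le\lfloor e/2\rfloor$, are indecomposable, projective and injective. -/

import Mathlib

open scoped TensorProduct DirectSum

noncomputable section

namespace SmallQuantum

/-- A primitive `n`-th root of unity `q` in `ℂ`, with `n ≠ 4`, and with `n > 2` so that
`q - q⁻¹ ≠ 0`. -/
structure RootDatum where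
  n : ℕ
  q : ℂ
  prim : IsPrimitiveRoot q n
  two_lt : 2 < n
  ne_four : n ≠ 4

variable (R : RootDatum)

/-- `d = n` for odd `n` and `d = n / 2` for even `n`. -/
def RootDatum.d : ℕ := if Odd R.n then R.n else R.n / 2

theorem RootDatum.two_lt_d : 2 < R.d := by
  have h1 := R.two_lt
  have h2 := R.ne_four
  unfold RootDatum.d
  split_ifs with h
  · exact h1
  · rw [Nat.not_odd_iff_even] at h
    obtain ⟨k, hk⟩ := h
    omega

instance RootDatum.d_neZero : NeZero R.d := ⟨by have := R.two_lt_d; omega⟩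

theorem RootDatum.q_ne_zero : R.q ≠ 0 :=
  R.prim.ne_zero (by have := R.two_lt; omega)

theorem RootDatum.sq_prim : IsPrimitiveRoot (R.q ^ 2) R.d := by
  unfold RootDatum.d
  split_ifs with h
  · exact R.prim.pow_of_coprime 2 (Nat.coprime_two_left.mpr h)
  · rw [Nat.not_odd_iff_even] at h
    obtain ⟨k, hk⟩ := h
    exact R.prim.pow (by have := R.two_lt; omega) (by omega)

/-! ### The algebra `u_q(sl_2)` -/

/-- Names of the three generators. -/
inductive Gen
  | E
  | F
  | K

/-- The defining relations, for three elements `e`, `f`, `k` of a complex algebra. Since `k ^ d = 1`,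
the inverse of `k` is `k ^ (d - 1)`. -/
structure IsTriple {A : Type*} [Ring A] [Algebra ℂ A] (e f k : A) : Prop where
  e_pow : e ^ R.d = 0
  f_pow : f ^ R.d = 0
  k_pow : k ^ R.d = 1
  k_e : k * e = R.q ^ 2 • (e * k)
  k_f : k * f = (R.q ^ 2)⁻¹ • (f * k)
  e_f : e * f - f * e = (R.q - R.q⁻¹)⁻¹ • (k - k ^ (R.d - 1))

open FreeAlgebra in
/-- The defining relations of `u_q`, as a relation on the free algebra on `E`, `F`, `K`. -/
inductive Rel : FreeAlgebra ℂ Gen → FreeAlgebra ℂ Gen → Prop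
  | e_pow : Rel (ι ℂ Gen.E ^ R.d) 0
  | f_pow : Rel (ι ℂ Gen.F ^ R.d) 0
  | k_pow : Rel (ι ℂ Gen.K ^ R.d) 1
  | k_e : Rel (ι ℂ Gen.K * ι ℂ Gen.E) (R.q ^ 2 • (ι ℂ Gen.E * ι ℂ Gen.K))
  | k_f : Rel (ι ℂ Gen.K * ι ℂ Gen.F) ((R.q ^ 2)⁻¹ • (ι ℂ Gen.F * ι ℂ Gen.K))
  | e_f : Rel (ι ℂ Gen.E * ι ℂ Gen.F - ι ℂ Gen.F * ι ℂ Gen.E)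
      ((R.q - R.q⁻¹)⁻¹ • (ι ℂ Gen.K - ι ℂ Gen.K ^ (R.d - 1)))

/-- The algebra `u_q = u_q(sl_2(ℂ))`: generators `E`, `F`, `K` and the relations above. -/
def Uq : Type := RingQuot (Rel R)

instance : Ring (Uq R) := inferInstanceAs (Ring (RingQuot (Rel R)))

instance : Algebra ℂ (Uq R) := inferInstanceAs (Algebra ℂ (RingQuot (Rel R)))

namespace Uq

/-- The generators of `u_q`. -/
def gen (g : Gen) : Uq R := RingQuot.mkAlgHom ℂ (Rel R) (FreeAlgebra.ι ℂ g)

theorem isTriple : IsTriple R (gen R Gen.E) (gen R Gen.F) (gen R Gen.K) where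
  e_pow := by
    have := RingQuot.mkAlgHom_rel ℂ (Rel.e_pow (R := R))
    rw [map_pow, map_zero] at this
    exact this
  f_pow := by
    have := RingQuot.mkAlgHom_rel ℂ (Rel.f_pow (R := R))
    rw [map_pow, map_zero] at this
    exact this
  k_pow := by
    have := RingQuot.mkAlgHom_rel ℂ (Rel.k_pow (R := R))
    rw [map_pow, map_one] at this
    exact this
  k_e := by
    have := RingQuot.mkAlgHom_rel ℂ (Rel.k_e (R := R))
    rw [map_mul, map_smul, map_mul] at this
    exact this
  k_f := by
    have := RingQuot.mkAlgHom_rel ℂ (Rel.k_f (R := R))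
    rw [map_mul, map_smul, map_mul] at this
    exact this
  e_f := by
    have := RingQuot.mkAlgHom_rel ℂ (Rel.e_f (R := R))
    rw [map_sub, map_mul, map_mul, map_smul, map_sub, map_pow] at this
    exact this

variable {R}

/-- The universal property of `u_q`. -/
def lift {A : Type*} [Ring A] [Algebra ℂ A] {e f k : A} (h : IsTriple R e f k) : Uq R →ₐ[ℂ] A :=
  RingQuot.liftAlgHom ℂ ⟨FreeAlgebra.lift ℂ (fun g => match g with
    | Gen.E => e
    | Gen.F => f
    | Gen.K => k), by
      intro x y hxy
      induction hxy with
      | e_pow => simpa using h.e_pow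
      | f_pow => simpa using h.f_pow
      | k_pow => simpa using h.k_pow
      | k_e => simpa using h.k_e
      | k_f => simpa using h.k_f
      | e_f => simpa using h.e_f⟩

theorem lift_E {A : Type*} [Ring A] [Algebra ℂ A] {e f k : A} (h : IsTriple R e f k) :
    lift h (gen R Gen.E) = e :=
  (RingQuot.liftAlgHom_mkAlgHom_apply ℂ _ _ _).trans (FreeAlgebra.lift_ι_apply _ _)

theorem lift_F {A : Type*} [Ring A] [Algebra ℂ A] {e f k : A} (h : IsTriple R e f k) :
    lift h (gen R Gen.F) = f :=
  (RingQuot.liftAlgHom_mkAlgHom_apply ℂ _ _ _).trans (FreeAlgebra.lift_ι_apply _ _)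

theorem lift_K {A : Type*} [Ring A] [Algebra ℂ A] {e f k : A} (h : IsTriple R e f k) :
    lift h (gen R Gen.K) = k :=
  (RingQuot.liftAlgHom_mkAlgHom_apply ℂ _ _ _).trans (FreeAlgebra.lift_ι_apply _ _)

end Uq

/-! ### The comultiplication -/

/-- Gaussian binomial coefficients, only used to show that the comultiplication respects the
nilpotency relations. -/
def gauss (z : ℂ) : ℕ → ℕ → ℂ
  | 0, 0 => 1
  | 0, _ + 1 => 0
  | _ + 1, 0 => 1
  | m + 1, k + 1 => gauss z m k + z ^ (k + 1) * gauss z m (k + 1)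

theorem gauss_zero_right (z : ℂ) (m : ℕ) : gauss z m 0 = 1 := by cases m <;> rfl

theorem gauss_of_lt (z : ℂ) (m : ℕ) : ∀ k, m < k → gauss z m k = 0 := by
  induction m with
  | zero => intro k hk; cases k with
    | zero => omega
    | succ k => rfl
  | succ m ih => intro k hk; cases k with
    | zero => omega
    | succ k => simp [gauss, ih k (by omega), ih (k + 1) (by omega)]

theorem gauss_self (z : ℂ) (m : ℕ) : gauss z m m = 1 := by
  induction m with
  | zero => rfl
  | succ m ih => simp [gauss, ih, gauss_of_lt z m (m + 1) (by omega)]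

theorem gauss_absorb (z : ℂ) (m : ℕ) :
    (∀ k, gauss z (m + 1) (k + 1) * (z ^ (k + 1) - 1) = (z ^ (m + 1) - 1) * gauss z m k) ∧
    (∀ k, gauss z (m + 1) k * (z ^ (m + 1) - z ^ k) = z ^ k * (z ^ (m + 1) - 1) * gauss z m k) := by
  induction m with
  | zero =>
    constructor
    · intro k
      rcases k with _ | k <;> simp [gauss]
    · intro k
      rcases k with _ | _ | k <;> simp [gauss]
  | succ m ih =>
    obtain ⟨ihA, ihB⟩ := ih
    constructor
    · intro k
      have hA := ihA k
      have hB := ihB k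
      have h : gauss z (m + 1 + 1) (k + 1)
          = gauss z (m + 1) k + z ^ (k + 1) * gauss z (m + 1) (k + 1) := rfl
      rw [h]
      linear_combination z ^ (k + 1) * hA - z * hB
    · intro k
      cases k with
      | zero => simp [gauss_zero_right]
      | succ k =>
        have hA := ihA k
        have hB := ihB k
        have h : gauss z (m + 1 + 1) (k + 1)
            = gauss z (m + 1) k + z ^ (k + 1) * gauss z (m + 1) (k + 1) := rfl
        rw [h]
        linear_combination z * hB - z ^ (k + 1) * hA

theorem add_pow_gauss {A : Type*} [Ring A] [Algebra ℂ A] (z : ℂ) (x y : A)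
    (h : y * x = z • (x * y)) (m : ℕ) :
    (x + y) ^ m = ∑ k ∈ Finset.range (m + 1), gauss z m k • (x ^ k * y ^ (m - k)) := by
  have hk : ∀ k : ℕ, y * x ^ k = z ^ k • (x ^ k * y) := by
    intro k
    induction k with
    | zero => simp
    | succ k ih =>
      rw [pow_succ, ← mul_assoc, ih, smul_mul_assoc, mul_assoc, h, mul_smul_comm, smul_smul,
        ← mul_assoc, ← pow_succ]
  induction m with
  | zero => simp [gauss]
  | succ m ih =>
    rw [pow_succ', ih, add_mul, Finset.mul_sum, Finset.mul_sum]
    have e1 : ∀ k ∈ Finset.range (m + 1), x * (gauss z m k • (x ^ k * y ^ (m - k)))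
        = gauss z m k • (x ^ (k + 1) * y ^ (m + 1 - (k + 1))) := by
      intro k _
      rw [mul_smul_comm, ← mul_assoc, ← pow_succ', Nat.add_sub_add_right]
    have e2 : ∀ k ∈ Finset.range (m + 1), y * (gauss z m k • (x ^ k * y ^ (m - k)))
        = (z ^ k * gauss z m k) • (x ^ k * y ^ (m + 1 - k)) := by
      intro k hk'
      have : m + 1 - k = (m - k) + 1 := by
        have := Finset.mem_range.mp hk'
        omega
      rw [mul_smul_comm, ← mul_assoc, hk, smul_mul_assoc, smul_smul, mul_assoc, ← pow_succ', this,
        mul_comm]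
    rw [Finset.sum_congr rfl e1, Finset.sum_congr rfl e2, Finset.sum_range_succ' _ (m + 1)]
    have e3 : ∑ k ∈ Finset.range (m + 1), (z ^ k * gauss z m k) • (x ^ k * y ^ (m + 1 - k))
        = ∑ k ∈ Finset.range (m + 1), (z ^ (k + 1) * gauss z m (k + 1)) •
            (x ^ (k + 1) * y ^ (m + 1 - (k + 1))) + y ^ (m + 1) := by
      have := Finset.sum_range_succ (fun k => (z ^ k * gauss z m k) • (x ^ k * y ^ (m + 1 - k)))
        (m + 1)
      rw [gauss_of_lt z m (m + 1) (by omega), mul_zero, zero_smul, add_zero] at this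
      rw [← this, Finset.sum_range_succ']
      simp [gauss_zero_right]
    rw [e3, ← add_assoc, ← Finset.sum_add_distrib]
    simp [gauss, add_smul]

theorem add_pow_eq_zero {A : Type*} [Ring A] [Algebra ℂ A] {z : ℂ} {m : ℕ}
    (hz : IsPrimitiveRoot z m) (hm : 0 < m) {x y : A} (h : y * x = z • (x * y))
    (hx : x ^ m = 0) (hy : y ^ m = 0) : (x + y) ^ m = 0 := by
  rw [add_pow_gauss z x y h]
  refine Finset.sum_eq_zero fun k hk => ?_
  have hk := Finset.mem_range.mp hk
  rcases Nat.eq_zero_or_pos k with rfl | hk0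
  · simp [hy]
  rcases Nat.lt_or_ge k m with hkm | hkm
  · obtain ⟨m, rfl⟩ : ∃ m', m = m' + 1 := ⟨m - 1, by omega⟩
    obtain ⟨k, rfl⟩ : ∃ k', k = k' + 1 := ⟨k - 1, by omega⟩
    have h1 := (gauss_absorb z m).1 k
    rw [hz.pow_eq_one, sub_self, zero_mul] at h1
    have h2 : z ^ (k + 1) - 1 ≠ 0 := sub_ne_zero.mpr (hz.pow_ne_one_of_pos_of_lt (by omega) hkm)
    rw [(mul_eq_zero.mp h1).resolve_right h2, zero_smul]
  · have : k = m := by omega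
    subst this
    simp [hx]

variable {R}

section Tensor

variable {A : Type*} [Ring A] [Algebra ℂ A] {e f k : A}

theorem IsTriple.k_inv (h : IsTriple R e f k) : k * k ^ (R.d - 1) = 1 ∧ k ^ (R.d - 1) * k = 1 := by
  have h1 : R.d - 1 + 1 = R.d := by have := R.two_lt_d; omega
  rw [← pow_succ', ← pow_succ, h1, h.k_pow]
  exact ⟨rfl, rfl⟩

theorem IsTriple.kinv_e (h : IsTriple R e f k) :
    k ^ (R.d - 1) * e = (R.q ^ 2)⁻¹ • (e * k ^ (R.d - 1)) := by
  have hq : R.q ^ 2 ≠ 0 := pow_ne_zero _ R.q_ne_zero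
  obtain ⟨h1, h2⟩ := h.k_inv
  have h3 : e = R.q ^ 2 • (k ^ (R.d - 1) * e * k) := by
    calc e = k ^ (R.d - 1) * (k * e) := by rw [← mul_assoc, h2, one_mul]
      _ = R.q ^ 2 • (k ^ (R.d - 1) * e * k) := by rw [h.k_e, mul_smul_comm, mul_assoc]
  calc k ^ (R.d - 1) * e = k ^ (R.d - 1) * e * k * k ^ (R.d - 1) := by
        rw [mul_assoc _ k, h1, mul_one]
    _ = (R.q ^ 2)⁻¹ • (e * k ^ (R.d - 1)) := by
        conv_rhs => rw [h3]
        rw [smul_mul_assoc, smul_smul, inv_mul_cancel₀ hq, one_smul]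

theorem IsTriple.kinv_f (h : IsTriple R e f k) :
    k ^ (R.d - 1) * f = R.q ^ 2 • (f * k ^ (R.d - 1)) := by
  have hq : R.q ^ 2 ≠ 0 := pow_ne_zero _ R.q_ne_zero
  obtain ⟨h1, h2⟩ := h.k_inv
  have h3 : f = (R.q ^ 2)⁻¹ • (k ^ (R.d - 1) * f * k) := by
    calc f = k ^ (R.d - 1) * (k * f) := by rw [← mul_assoc, h2, one_mul]
      _ = (R.q ^ 2)⁻¹ • (k ^ (R.d - 1) * f * k) := by rw [h.k_f, mul_smul_comm, mul_assoc]
  calc k ^ (R.d - 1) * f = k ^ (R.d - 1) * f * k * k ^ (R.d - 1) := by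
        rw [mul_assoc _ k, h1, mul_one]
    _ = R.q ^ 2 • (f * k ^ (R.d - 1)) := by
        conv_rhs => rw [h3]
        rw [smul_mul_assoc, smul_smul, mul_inv_cancel₀ hq, one_smul]

theorem IsTriple.tensor (h : IsTriple R e f k) :
    IsTriple R ((1 : A) ⊗ₜ[ℂ] e + e ⊗ₜ[ℂ] k) ((k ^ (R.d - 1)) ⊗ₜ[ℂ] f + f ⊗ₜ[ℂ] (1 : A))
      (k ⊗ₜ[ℂ] k) := by
  have hd : 0 < R.d := by have := R.two_lt_d; omega
  have hq : R.q ^ 2 ≠ 0 := pow_ne_zero _ R.q_ne_zero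
  obtain ⟨hk1, hk2⟩ := h.k_inv
  constructor
  · refine add_pow_eq_zero R.sq_prim hd ?_ ?_ ?_
    · simp only [Algebra.TensorProduct.tmul_mul_tmul, h.k_e, one_mul, mul_one,
        TensorProduct.tmul_smul]
    · simp [Algebra.TensorProduct.tmul_pow, h.e_pow]
    · simp [Algebra.TensorProduct.tmul_pow, h.e_pow]
  · rw [add_comm]
    refine add_pow_eq_zero R.sq_prim hd ?_ ?_ ?_
    · simp only [Algebra.TensorProduct.tmul_mul_tmul, h.kinv_f, one_mul, mul_one,
        TensorProduct.smul_tmul']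
    · simp [Algebra.TensorProduct.tmul_pow, h.f_pow]
    · simp [Algebra.TensorProduct.tmul_pow, h.f_pow]
  · simp [Algebra.TensorProduct.tmul_pow, h.k_pow, Algebra.TensorProduct.one_def]
  · simp only [mul_add, add_mul, Algebra.TensorProduct.tmul_mul_tmul, h.k_e, one_mul, mul_one,
      TensorProduct.tmul_smul, smul_add, TensorProduct.smul_tmul']
  · simp only [mul_add, add_mul, Algebra.TensorProduct.tmul_mul_tmul, h.k_f, one_mul, mul_one,
      TensorProduct.tmul_smul, smul_add, TensorProduct.smul_tmul', hk1, hk2]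
  · have e1 : (e * k ^ (R.d - 1)) ⊗ₜ[ℂ] (k * f) = (k ^ (R.d - 1) * e) ⊗ₜ[ℂ] (f * k) := by
      rw [h.k_f, h.kinv_e, TensorProduct.tmul_smul, TensorProduct.smul_tmul']
    have e2 : ∀ a : A, a ⊗ₜ[ℂ] (e * f) = a ⊗ₜ[ℂ] (f * e)
        + (R.q - R.q⁻¹)⁻¹ • (a ⊗ₜ[ℂ] (k - k ^ (R.d - 1))) := by
      intro a
      rw [← TensorProduct.tmul_smul, ← h.e_f, TensorProduct.tmul_sub]
      abel
    have e3 : ∀ a : A, (e * f) ⊗ₜ[ℂ] a = (f * e) ⊗ₜ[ℂ] a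
        + (R.q - R.q⁻¹)⁻¹ • ((k - k ^ (R.d - 1)) ⊗ₜ[ℂ] a) := by
      intro a
      rw [TensorProduct.smul_tmul', ← h.e_f, TensorProduct.sub_tmul]
      abel
    simp only [mul_add, add_mul, Algebra.TensorProduct.tmul_mul_tmul, one_mul, mul_one,
      Algebra.TensorProduct.tmul_pow, e1, e2, e3, TensorProduct.tmul_sub, TensorProduct.sub_tmul,
      smul_sub]
    abel

end Tensor

variable (R) in
/-- The comultiplication of `u_q`: `Δ(E) = 1 ⊗ E + E ⊗ K`, `Δ(F) = K⁻¹ ⊗ F + F ⊗ 1`,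
`Δ(K) = K ⊗ K`. -/
def Uq.comul : Uq R →ₐ[ℂ] Uq R ⊗[ℂ] Uq R := Uq.lift (Uq.isTriple R).tensor

/-! ### Modules over `u_q` -/

variable (R) in
/-- A left `u_q`-module: a complex vector space with an action of `u_q`. -/
structure UqMod where
  V : Type
  [addCommGroup : AddCommGroup V]
  [module : Module ℂ V]
  ρ : Uq R →ₐ[ℂ] Module.End ℂ V

namespace UqMod

instance : CoeSort (UqMod R) Type := ⟨UqMod.V⟩

instance (X : UqMod R) : AddCommGroup X := X.addCommGroup

instance (X : UqMod R) : Module ℂ X := X.module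

instance (X : UqMod R) : Module (Uq R) X := Module.compHom X X.ρ.toRingHom

theorem smul_def (X : UqMod R) (a : Uq R) (x : X) : a • x = X.ρ a x := rfl

/-- The tensor product over `ℂ` of two `u_q`-modules; `u_q` acts through the comultiplication. -/
def tensor (X Y : UqMod R) : UqMod R where
  V := X ⊗[ℂ] Y
  ρ := ((Module.endTensorEndAlgHom (R := ℂ) (S := ℂ) (A := ℂ) (M := X) (N := Y)).comp
    (Algebra.TensorProduct.map X.ρ Y.ρ)).comp (Uq.comul R)

end UqMod

/-- A module over a ring is indecomposable if it is nonzero and not the direct sum of two nonzero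
submodules. -/
def IsIndecomposable (A M : Type*) [Ring A] [AddCommGroup M] [Module A M] : Prop :=
  Nontrivial M ∧ ∀ N N' : Submodule A M, IsCompl N N' → N = ⊥ ∨ N' = ⊥

/-! ### The modules -/

section Scalars

/-- The scalar `q ^ (2 i)` for a class `i` modulo `d`; it does not depend on the representative. -/
def kw (i : ZMod R.d) : ℂ := R.q ^ (2 * i.val)

/-- The quantum integer `[2 i] = (q ^ (2 i) - q ^ (-2 i)) / (q - q⁻¹)` for a class `i` modulo `d`. -/
def br (i : ZMod R.d) : ℂ := (kw i - (kw i)⁻¹) / (R.q - R.q⁻¹)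

/-- The scalar `lam i j = - ∑_{0 ≤ h < j} [2 (i + h)]`, by which `F` maps the `j`-th basis vector to
the `(j - 1)`-st one. -/
def lam (i : ZMod R.d) (j : ℕ) : ℂ := -∑ h ∈ Finset.range j, br (i + (h : ZMod R.d))

theorem kw_natCast (m : ℕ) : kw (m : ZMod R.d) = R.q ^ (2 * m) := by
  unfold kw
  rw [ZMod.val_natCast, pow_mul, pow_mul]
  exact (pow_mod_orderOf (R.q ^ 2) m) ▸ by rw [R.sq_prim.eq_orderOf.symm]

theorem kw_add (i j : ZMod R.d) : kw (i + j) = kw i * kw j := by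
  have hi : i = ((i.val : ℕ) : ZMod R.d) := (ZMod.natCast_zmod_val i).symm
  have hj : j = ((j.val : ℕ) : ZMod R.d) := (ZMod.natCast_zmod_val j).symm
  rw [hi, hj, ← Nat.cast_add, kw_natCast, kw_natCast, kw_natCast, mul_add, pow_add]

theorem kw_zero : kw (0 : ZMod R.d) = 1 := by simp [kw]

theorem kw_one : kw (1 : ZMod R.d) = R.q ^ 2 := by
  have := kw_natCast (R := R) 1
  simpa using this

theorem kw_ne_zero (i : ZMod R.d) : kw i ≠ 0 := pow_ne_zero _ R.q_ne_zero

theorem kw_neg (i : ZMod R.d) : kw (-i) = (kw i)⁻¹ := by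
  have := kw_add i (-i)
  rw [add_neg_cancel, kw_zero] at this
  exact eq_inv_of_mul_eq_one_right this.symm

theorem kw_pow (i : ZMod R.d) (m : ℕ) : kw i ^ m = kw ((m : ZMod R.d) * i) := by
  induction m with
  | zero => simp [kw_zero]
  | succ m ih => rw [pow_succ, ih, ← kw_add]; congr 1; push_cast; ring

theorem kw_pow_d (i : ZMod R.d) : kw i ^ R.d = 1 := by simp [kw_pow, kw_zero]

theorem br_neg (i : ZMod R.d) : br (-i) = -br i := by
  unfold br
  rw [kw_neg, inv_inv]
  ring

theorem lam_zero (i : ZMod R.d) : lam i 0 = 0 := by simp [lam]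

theorem lam_succ (i : ZMod R.d) (j : ℕ) : lam i (j + 1) = lam i j - br (i + (j : ZMod R.d)) := by
  unfold lam
  rw [Finset.sum_range_succ]
  ring

/-- The sum over the first `u + 1` terms vanishes for `u ≡ -2 i`, by the symmetry `h ↦ u - h`. -/
theorem lam_eq_zero {i : ZMod R.d} {u : ℕ} (h : (u : ZMod R.d) = -2 * i) : lam i (u + 1) = 0 := by
  have h1 : ∑ t ∈ Finset.range (u + 1), br (i + (t : ZMod R.d))
      = -∑ t ∈ Finset.range (u + 1), br (i + (t : ZMod R.d)) := by
    conv_lhs => rw [← Finset.sum_range_reflect]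
    rw [← Finset.sum_neg_distrib]
    refine Finset.sum_congr rfl fun t ht => ?_
    have ht := Finset.mem_range.mp ht
    rw [← br_neg]
    congr 1
    rw [show u + 1 - 1 - t = u - t by omega, Nat.cast_sub (by omega), h]
    ring
  have h2 : ∑ t ∈ Finset.range (u + 1), br (i + (t : ZMod R.d)) = 0 := self_eq_neg.mp h1
  rw [lam, h2, neg_zero]

theorem sum_kw (i : ZMod R.d) : ∑ t ∈ Finset.range R.d, kw (i + (t : ZMod R.d)) = 0 := by
  have h := R.sq_prim.geom_sum_eq_zero (by have := R.two_lt_d; omega)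
  have : ∀ t ∈ Finset.range R.d, kw (i + (t : ZMod R.d)) = kw i * (R.q ^ 2) ^ t := by
    intro t _
    rw [kw_add, kw_natCast, pow_mul]
  rw [Finset.sum_congr rfl this, ← Finset.mul_sum, h, mul_zero]

theorem sum_kw_inv (i : ZMod R.d) : ∑ t ∈ Finset.range R.d, (kw (i + (t : ZMod R.d)))⁻¹ = 0 := by
  have h := R.sq_prim.inv.geom_sum_eq_zero (by have := R.two_lt_d; omega)
  have : ∀ t ∈ Finset.range R.d, (kw (i + (t : ZMod R.d)))⁻¹ = (kw i)⁻¹ * ((R.q ^ 2)⁻¹) ^ t := by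
    intro t _
    rw [kw_add, kw_natCast, pow_mul, mul_inv, inv_pow]
  rw [Finset.sum_congr rfl this, ← Finset.mul_sum, h, mul_zero]

theorem lam_d (i : ZMod R.d) : lam i R.d = 0 := by
  unfold lam br
  rw [← Finset.sum_div, Finset.sum_sub_distrib, sum_kw, sum_kw_inv]
  simp

end Scalars

section Chain

/-- The `m`-th vector `e^m` of the standard basis `e^0, …, e^(N-1)` of `ℂ^N`, with `e^m = 0` for
`m ≥ N`. -/
def vec (N m : ℕ) : Fin N → ℂ := fun t => if (t : ℕ) = m then 1 else 0

/-- The linear map on `ℂ^N` with prescribed values on `e^0, …, e^(N-1)`. -/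
def onVec {W : Type} [AddCommGroup W] [Module ℂ W] (N : ℕ) (g : ℕ → W) : (Fin N → ℂ) →ₗ[ℂ] W :=
  (Pi.basisFun ℂ (Fin N)).constr ℂ (fun j : Fin N => g j)

theorem vec_of_le {N m : ℕ} (h : N ≤ m) : vec N m = 0 := by
  funext t
  have := t.2
  simp only [vec, Pi.zero_apply, ite_eq_right_iff, one_ne_zero]
  omega

theorem basisFun_eq_vec {N : ℕ} (j : Fin N) : Pi.basisFun ℂ (Fin N) j = vec N j := by
  funext t
  simp [vec, Pi.single_apply, Fin.ext_iff]

theorem onVec_vec {W : Type} [AddCommGroup W] [Module ℂ W] {N : ℕ} (g : ℕ → W) {m : ℕ} (h : m < N) :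
    onVec N g (vec N m) = g m := by
  have := basisFun_eq_vec (⟨m, h⟩ : Fin N)
  rw [← this, onVec, Module.Basis.constr_basis]

theorem ext_vec {W : Type} [AddCommGroup W] [Module ℂ W] {N : ℕ} {f g : (Fin N → ℂ) →ₗ[ℂ] W}
    (h : ∀ m < N, f (vec N m) = g (vec N m)) : f = g := by
  refine (Pi.basisFun ℂ (Fin N)).ext fun j => ?_
  rw [basisFun_eq_vec]
  exact h j j.2

/-- `E e^j = e^(j+1)`, and `E e^(N-1) = 0`. -/
def opE (N : ℕ) : Module.End ℂ (Fin N → ℂ) := onVec N fun j => vec N (j + 1)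

/-- `K e^j = q ^ (2 (i + j)) e^j`. -/
def opK (i : ZMod R.d) (N : ℕ) : Module.End ℂ (Fin N → ℂ) :=
  onVec N fun j => kw (i + (j : ZMod R.d)) • vec N j

/-- `F e^j = lam i j • e^(j-1)`, and `F e^0 = 0` (as `lam i 0 = 0`). -/
def opF (i : ZMod R.d) (N : ℕ) : Module.End ℂ (Fin N → ℂ) :=
  onVec N fun j => lam i j • vec N (j - 1)

theorem opE_vec (N m : ℕ) : opE N (vec N m) = vec N (m + 1) := by
  rcases Nat.lt_or_ge m N with h | h
  · exact onVec_vec _ h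
  · rw [vec_of_le h, vec_of_le (by omega), map_zero]

theorem opK_vec (i : ZMod R.d) (N m : ℕ) :
    opK i N (vec N m) = kw (i + (m : ZMod R.d)) • vec N m := by
  rcases Nat.lt_or_ge m N with h | h
  · exact onVec_vec _ h
  · rw [vec_of_le h, map_zero, smul_zero]

theorem opF_vec {i : ZMod R.d} {N : ℕ} (hN : lam i N = 0) (m : ℕ) :
    opF i N (vec N m) = lam i m • vec N (m - 1) := by
  rcases Nat.lt_or_ge m N with h | h
  · exact onVec_vec _ h
  · rw [vec_of_le h, map_zero]
    rcases Nat.eq_or_lt_of_le h with rfl | h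
    · rw [hN, zero_smul]
    · rw [vec_of_le (by omega), smul_zero]

theorem opE_pow_vec (N m t : ℕ) : (opE N ^ t) (vec N m) = vec N (m + t) := by
  induction t with
  | zero => rfl
  | succ t ih => rw [pow_succ', Module.End.mul_apply, ih, opE_vec]; rfl

theorem opK_pow_vec (i : ZMod R.d) (N m t : ℕ) :
    (opK i N ^ t) (vec N m) = kw (i + (m : ZMod R.d)) ^ t • vec N m := by
  induction t with
  | zero => simp
  | succ t ih => rw [pow_succ', Module.End.mul_apply, ih, map_smul, opK_vec, smul_smul, pow_succ]

theorem opF_pow_vec {i : ZMod R.d} {N : ℕ} (hN : lam i N = 0) (m : ℕ) :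
    (opF i N ^ (m + 1)) (vec N m) = 0 := by
  induction m with
  | zero => rw [zero_add, pow_one, opF_vec hN, lam_zero, zero_smul]
  | succ m ih =>
    rw [pow_succ, Module.End.mul_apply, opF_vec hN, map_smul, Nat.add_sub_cancel, ih, smul_zero]

theorem opF_pow_vec_of_lt {i : ZMod R.d} {N : ℕ} (hN : lam i N = 0) {m t : ℕ} (h : m < t) :
    (opF i N ^ t) (vec N m) = 0 := by
  obtain ⟨s, rfl⟩ : ∃ s, t = s + (m + 1) := ⟨t - (m + 1), by omega⟩
  rw [pow_add, Module.End.mul_apply, opF_pow_vec hN, map_zero]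

theorem kw_pow_pred (i : ZMod R.d) : kw i ^ (R.d - 1) = (kw i)⁻¹ := by
  refine eq_inv_of_mul_eq_one_left ?_
  rw [← pow_succ, Nat.sub_add_cancel (by have := R.two_lt_d; omega), kw_pow_d]

theorem chain_isTriple {i : ZMod R.d} {N : ℕ} (hd : N ≤ R.d) (hN : lam i N = 0) :
    IsTriple R (opE N) (opF i N) (opK i N) where
  e_pow := ext_vec fun m _ => by
    rw [opE_pow_vec, vec_of_le (by omega)]; rfl
  f_pow := ext_vec fun m hm => by
    rw [opF_pow_vec_of_lt hN (by omega)]; rfl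
  k_pow := ext_vec fun m _ => by
    rw [opK_pow_vec, kw_pow_d, one_smul]; rfl
  k_e := ext_vec fun m _ => by
    rw [LinearMap.smul_apply, Module.End.mul_apply, Module.End.mul_apply, opE_vec, opK_vec, opK_vec,
      map_smul, opE_vec, smul_smul, ← kw_one, ← kw_add]
    congr 2
    push_cast
    ring
  k_f := ext_vec fun m _ => by
    rw [LinearMap.smul_apply, Module.End.mul_apply, Module.End.mul_apply, opK_vec, map_smul,
      opF_vec hN, map_smul, opK_vec]
    cases m with
    | zero => simp [lam_zero]
    | succ m =>
      have h1 : kw (i + ((m + 1 : ℕ) : ZMod R.d)) = kw (i + (m : ZMod R.d)) * R.q ^ 2 := by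
        rw [← kw_one, ← kw_add]
        congr 1
        push_cast
        ring
      have hq : R.q ^ 2 ≠ 0 := pow_ne_zero _ R.q_ne_zero
      rw [smul_smul, smul_smul, smul_smul, Nat.add_sub_cancel, h1]
      congr 1
      rw [mul_comm (kw _) (R.q ^ 2), inv_mul_cancel_left₀ hq, mul_comm]
  e_f := ext_vec fun m _ => by
    rw [LinearMap.sub_apply, LinearMap.smul_apply, LinearMap.sub_apply, Module.End.mul_apply,
      Module.End.mul_apply, opE_vec, opF_vec hN, opF_vec hN, map_smul, opE_vec, opK_pow_vec,
      opK_vec, kw_pow_pred, lam_succ, ← sub_smul, smul_smul, Nat.add_sub_cancel, br]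
    cases m with
    | zero =>
      rw [lam_zero, zero_smul, zero_sub, ← neg_smul]
      congr 1
      ring
    | succ m =>
      rw [Nat.add_sub_cancel, ← sub_smul]
      congr 1
      ring

/-- The `u_q`-module on `ℂ^N` with basis `e^0, …, e^(N-1)` and
`K e^j = q ^ (2 (i + j)) e^j`, `E e^j = e^(j+1)`, `F e^j = lam i j • e^(j-1)`. -/
def chain (i : ZMod R.d) (N : ℕ) (hd : N ≤ R.d) (hN : lam i N = 0) : UqMod R where
  V := Fin N → ℂ
  ρ := Uq.lift (chain_isTriple hd hN)

end Chain

/-- The pairs `(i, u)` with `0 ≤ u ≤ d - 1` and `u ≡ -2 i` modulo `d`; these index the simple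
`u_q`-modules. -/
def IsSimplePair (i : ZMod R.d) (u : ℕ) : Prop := u < R.d ∧ (u : ZMod R.d) = -2 * i

/-- The simple `u_q`-module of dimension `u + 1`, with basis `e_i^0, …, e_i^u`. -/
def simpleMod (i : ZMod R.d) (u : ℕ) (h : IsSimplePair i u) : UqMod R :=
  chain i (u + 1) h.1 (lam_eq_zero h.2)

theorem IsSimplePair.tensor {i j : ZMod R.d} {u v l : ℕ} (hu : IsSimplePair i u)
    (hv : IsSimplePair j v) {e : ℕ} (he : u + v = R.d - 1 + e)
    (hl : l ∈ Finset.Icc (e + 1) (min u v)) :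
    IsSimplePair (i + j + (l : ZMod R.d)) (u + v - 2 * l) := by
  have hl := Finset.mem_Icc.mp hl
  have h1 := hl.1
  have h2 : l ≤ u := hl.2.trans (min_le_left _ _)
  have h3 : l ≤ v := hl.2.trans (min_le_right _ _)
  refine ⟨by have := R.two_lt_d; omega, ?_⟩
  rw [Nat.cast_sub (by omega)]
  push_cast
  rw [hu.2, hv.2]
  ring

section Big

/-- The action of `F` on `P_k ⊕ P_{1-k}` (both copies of `ℂ^d`), where `a` is the representative of
`-2 k` in `{0, …, d - 1}`: `F e_k^j = lam k j • e_k^(j-1)` and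
`F e_{1-k}^j = e_k^(a+j) + lam (1-k) j • e_{1-k}^(j-1)`, where `e_k^(a+j) = 0` if `a + j ≥ d`. -/
def bigF (k : ZMod R.d) : Module.End ℂ ((Fin R.d → ℂ) × (Fin R.d → ℂ)) :=
  LinearMap.coprod ((opF k R.d).prod 0)
    (onVec R.d fun j => (vec R.d ((-2 * k).val + j), lam (1 - k) j • vec R.d (j - 1)))

/-- The action of `E` on `P_k ⊕ P_{1-k}`. -/
def bigE : Module.End ℂ ((Fin R.d → ℂ) × (Fin R.d → ℂ)) :=
  LinearMap.prodMap (opE R.d) (opE R.d)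

/-- The action of `K` on `P_k ⊕ P_{1-k}`. -/
def bigK (k : ZMod R.d) : Module.End ℂ ((Fin R.d → ℂ) × (Fin R.d → ℂ)) :=
  LinearMap.prodMap (opK k R.d) (opK (1 - k) R.d)

theorem ext_big {f g : Module.End ℂ ((Fin R.d → ℂ) × (Fin R.d → ℂ))}
    (h1 : ∀ m < R.d, f (vec R.d m, 0) = g (vec R.d m, 0))
    (h2 : ∀ m < R.d, f (0, vec R.d m) = g (0, vec R.d m)) : f = g :=
  LinearMap.prod_ext (ext_vec fun m hm => by simpa using h1 m hm)
    (ext_vec fun m hm => by simpa using h2 m hm)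

theorem bigF_left (k : ZMod R.d) (m : ℕ) :
    bigF k (vec R.d m, 0) = (lam k m • vec R.d (m - 1), 0) := by
  simp [bigF, opF_vec (lam_d k)]

theorem bigF_right (k : ZMod R.d) (m : ℕ) : bigF k (0, vec R.d m)
    = (vec R.d ((-2 * k).val + m), lam (1 - k) m • vec R.d (m - 1)) := by
  rcases Nat.lt_or_ge m R.d with h | h
  · simp [bigF, onVec_vec _ h]
  · rcases Nat.eq_or_lt_of_le h with rfl | h'
    · rw [vec_of_le h, vec_of_le (by omega), lam_d, zero_smul]
      exact map_zero _
    · rw [vec_of_le h, vec_of_le (by omega), vec_of_le (by omega), smul_zero]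
      exact map_zero _

theorem bigE_left (m : ℕ) : bigE (R := R) (vec R.d m, 0) = (vec R.d (m + 1), 0) := by
  simp [bigE, opE_vec]

theorem bigE_right (m : ℕ) : bigE (R := R) (0, vec R.d m) = (0, vec R.d (m + 1)) := by
  simp [bigE, opE_vec]

theorem bigK_left (k : ZMod R.d) (m : ℕ) :
    bigK k (vec R.d m, 0) = kw (k + (m : ZMod R.d)) • (vec R.d m, 0) := by
  simp [bigK, opK_vec]

theorem bigK_right (k : ZMod R.d) (m : ℕ) :
    bigK k (0, vec R.d m) = kw (1 - k + (m : ZMod R.d)) • (0, vec R.d m) := by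
  simp [bigK, opK_vec]

theorem bigE_pow_right (m t : ℕ) :
    (bigE (R := R) ^ t) (0, vec R.d m) = (0, vec R.d (m + t)) := by
  induction t with
  | zero => rfl
  | succ t ih => rw [pow_succ', Module.End.mul_apply, ih, bigE_right]; rfl

theorem bigE_pow_left (m t : ℕ) :
    (bigE (R := R) ^ t) (vec R.d m, 0) = (vec R.d (m + t), 0) := by
  induction t with
  | zero => rfl
  | succ t ih => rw [pow_succ', Module.End.mul_apply, ih, bigE_left]; rfl

theorem bigF_pow_left (k : ZMod R.d) (t : ℕ) (x : Fin R.d → ℂ) :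
    (bigF k ^ t) (x, 0) = ((opF k R.d ^ t) x, 0) := by
  induction t with
  | zero => rfl
  | succ t ih => rw [pow_succ', Module.End.mul_apply, ih, pow_succ', Module.End.mul_apply]; simp [bigF]

theorem bigK_pow_left (k : ZMod R.d) (m t : ℕ) :
    (bigK k ^ t) (vec R.d m, 0) = kw (k + (m : ZMod R.d)) ^ t • (vec R.d m, 0) := by
  induction t with
  | zero => simp
  | succ t ih => rw [pow_succ', Module.End.mul_apply, ih, map_smul, bigK_left, smul_smul, pow_succ]

theorem bigK_pow_right (k : ZMod R.d) (m t : ℕ) :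
    (bigK k ^ t) (0, vec R.d m) = kw (1 - k + (m : ZMod R.d)) ^ t • (0, vec R.d m) := by
  induction t with
  | zero => simp
  | succ t ih => rw [pow_succ', Module.End.mul_apply, ih, map_smul, bigK_right, smul_smul, pow_succ]

theorem big_e_f (k : ZMod R.d) : bigE * bigF k - bigF k * bigE
    = (R.q - R.q⁻¹)⁻¹ • (bigK k - bigK k ^ (R.d - 1)) := by
  refine ext_big (fun m _ => ?_) (fun m _ => ?_)
  · rw [LinearMap.sub_apply, LinearMap.smul_apply, LinearMap.sub_apply, Module.End.mul_apply,
      Module.End.mul_apply, bigE_left, bigF_left, bigF_left, bigK_left, bigK_pow_left,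
      kw_pow_pred, lam_succ, ← sub_smul, smul_smul, Nat.add_sub_cancel, br]
    cases m with
    | zero =>
      ext t <;> simp [bigE, lam_zero]
      left
      ring
    | succ m =>
      ext t <;> simp [bigE, opE_vec]
      ring
  · rw [LinearMap.sub_apply, LinearMap.smul_apply, LinearMap.sub_apply, Module.End.mul_apply,
      Module.End.mul_apply, bigE_right, bigF_right, bigF_right, bigK_right, bigK_pow_right,
      kw_pow_pred, lam_succ, ← sub_smul, smul_smul, Nat.add_sub_cancel, br]
    cases m with
    | zero =>
      ext t <;> simp [bigE, lam_zero, opE_vec]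
      left
      ring
    | succ m =>
      ext t <;> simp [bigE, opE_vec, add_assoc]
      ring

theorem big_k_e (k : ZMod R.d) : bigK k * bigE = R.q ^ 2 • (bigE * bigK k) := by
  have h : ∀ w : ZMod R.d, ∀ m : ℕ,
      kw (w + ((m + 1 : ℕ) : ZMod R.d)) = R.q ^ 2 * kw (w + (m : ZMod R.d)) := by
    intro w m
    rw [← kw_one, ← kw_add]
    congr 1
    push_cast
    ring
  refine ext_big (fun m _ => ?_) (fun m _ => ?_)
  · rw [LinearMap.smul_apply, Module.End.mul_apply, Module.End.mul_apply, bigE_left, bigK_left,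
      bigK_left, map_smul, bigE_left, smul_smul, h]
  · rw [LinearMap.smul_apply, Module.End.mul_apply, Module.End.mul_apply, bigE_right, bigK_right,
      bigK_right, map_smul, bigE_right, smul_smul, h]

theorem big_k_f (k : ZMod R.d) : bigK k * bigF k = (R.q ^ 2)⁻¹ • (bigF k * bigK k) := by
  have hq : R.q ^ 2 ≠ 0 := pow_ne_zero _ R.q_ne_zero
  have h : ∀ w : ZMod R.d, ∀ m : ℕ,
      kw (w + ((m + 1 : ℕ) : ZMod R.d)) = R.q ^ 2 * kw (w + (m : ZMod R.d)) := by
    intro w m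
    rw [← kw_one, ← kw_add]
    congr 1
    push_cast
    ring
  have ha : (((-2 * k).val : ℕ) : ZMod R.d) = -2 * k := ZMod.natCast_zmod_val _
  have h' : ∀ m : ℕ, kw (1 - k + (m : ZMod R.d))
      = R.q ^ 2 * kw (k + (((-2 * k).val + m : ℕ) : ZMod R.d)) := by
    intro m
    rw [← kw_one, ← kw_add, Nat.cast_add, ha]
    congr 1
    ring
  refine ext_big (fun m _ => ?_) (fun m _ => ?_)
  · rw [LinearMap.smul_apply, Module.End.mul_apply, Module.End.mul_apply, bigF_left, bigK_left,
      map_smul, bigF_left]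
    cases m with
    | zero =>
      rw [lam_zero, zero_smul, Prod.mk_zero_zero, map_zero, smul_zero, smul_zero]
    | succ m =>
      rw [Nat.add_sub_cancel, h, smul_smul, ← mul_assoc, inv_mul_cancel₀ hq, one_mul]
      ext t <;> simp [bigK, opK_vec]
      ring
  · rw [LinearMap.smul_apply, Module.End.mul_apply, Module.End.mul_apply, bigF_right, bigK_right,
      map_smul, bigF_right, h', smul_smul, ← mul_assoc, inv_mul_cancel₀ hq, one_mul]
    cases m with
    | zero => ext t <;> simp [bigK, lam_zero, opK_vec]
    | succ m =>
      have h2 := (h' (m + 1)).symm.trans (h (1 - k) m)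
      have h3 := mul_left_cancel₀ hq h2
      rw [h3]
      ext t <;> simp [bigK, opK_vec, ← h3]
      ring

theorem bigK_bigF_pow (k : ZMod R.d) (m t : ℕ) : bigK k ((bigF k ^ t) (0, vec R.d m))
    = kw (1 - k + (m : ZMod R.d) - (t : ZMod R.d)) • (bigF k ^ t) (0, vec R.d m) := by
  induction t with
  | zero => simpa using bigK_right k m
  | succ t ih =>
    have h := LinearMap.congr_fun (big_k_f k) ((bigF k ^ t) (0, vec R.d m))
    rw [LinearMap.smul_apply, Module.End.mul_apply, Module.End.mul_apply, ih, map_smul,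
      smul_smul, ← kw_one, ← kw_neg, ← kw_add] at h
    rw [pow_succ', Module.End.mul_apply, h]
    congr 2
    push_cast
    ring

theorem bigK_bigF_pow' (k : ZMod R.d) (m t s : ℕ) : (bigK k ^ s) ((bigF k ^ t) (0, vec R.d m))
    = kw (1 - k + (m : ZMod R.d) - (t : ZMod R.d)) ^ s • (bigF k ^ t) (0, vec R.d m) := by
  induction s with
  | zero => simp
  | succ s ih =>
    rw [pow_succ', Module.End.mul_apply, ih, map_smul, bigK_bigF_pow, smul_smul, pow_succ]

theorem bigE_bigF_pow (k : ZMod R.d) (m t : ℕ) :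
    bigE ((bigF k ^ (t + 1)) (0, vec R.d m)) = (bigF k ^ (t + 1)) (0, vec R.d (m + 1))
      + (∑ s ∈ Finset.range (t + 1), br (1 - k + (m : ZMod R.d) - (s : ZMod R.d))) •
        (bigF k ^ t) (0, vec R.d m) := by
  have key : ∀ t : ℕ, bigE ((bigF k ^ (t + 1)) (0, vec R.d m))
      = bigF k (bigE ((bigF k ^ t) (0, vec R.d m)))
        + br (1 - k + (m : ZMod R.d) - (t : ZMod R.d)) • (bigF k ^ t) (0, vec R.d m) := by
    intro t
    have h := LinearMap.congr_fun (big_e_f k) ((bigF k ^ t) (0, vec R.d m))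
    rw [LinearMap.sub_apply, LinearMap.smul_apply, LinearMap.sub_apply, Module.End.mul_apply,
      Module.End.mul_apply, bigK_bigF_pow, bigK_bigF_pow', kw_pow_pred, ← sub_smul, smul_smul,
      sub_eq_iff_eq_add'] at h
    rw [pow_succ', Module.End.mul_apply, h, br, div_eq_inv_mul]
  induction t with
  | zero =>
    rw [key]
    simp [bigE_right]
  | succ t ih =>
    rw [key, ih, map_add, map_smul, Finset.sum_range_succ _ (t + 1), add_smul, ← add_assoc]
    simp only [pow_succ', Module.End.mul_apply]

theorem bigF_pow_d {k : ZMod R.d} (hk : 2 * k ≠ 1) (m : ℕ) :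
    (bigF k ^ R.d) (0, vec R.d m) = 0 := by
  have hd := R.two_lt_d
  obtain ⟨D, hD⟩ : ∃ D, R.d = D + 1 := ⟨R.d - 1, by omega⟩
  induction m with
  | zero =>
    have ha : (-2 * k).val < D := by
      have h1 := ZMod.val_lt (-2 * k)
      refine lt_of_le_of_ne (by omega) fun h => hk ?_
      have h2 : ((R.d : ℕ) : ZMod R.d) = 0 := ZMod.natCast_self _
      have h3 : (((-2 * k).val : ℕ) : ZMod R.d) = -2 * k := ZMod.natCast_zmod_val _
      have h4 : ((R.d : ℕ) : ZMod R.d) = (((-2 * k).val : ℕ) : ZMod R.d) + 1 := by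
        rw [h]
        exact_mod_cast congrArg (Nat.cast (R := ZMod R.d)) hD
      rw [h2, h3] at h4
      linear_combination h4
    have h1 : bigF k (0, vec R.d 0) = (vec R.d (-2 * k).val, 0) := by
      rw [bigF_right, lam_zero, zero_smul, add_zero]
    have h2 : bigF k ^ R.d = bigF k ^ D * bigF k := by
      rw [← pow_succ]
      exact congrArg _ hD
    rw [h2, Module.End.mul_apply, h1, bigF_pow_left, opF_pow_vec_of_lt (lam_d k) ha]
    rfl
  | succ m ih =>
    have h := bigE_bigF_pow k m (R.d - 1)
    have hd' : R.d - 1 + 1 = R.d := by omega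
    rw [hd', ih, map_zero] at h
    have hs : ∑ s ∈ Finset.range R.d, br (1 - k + (m : ZMod R.d) - (s : ZMod R.d)) = 0 := by
      have h1 := lam_d (-(1 - k + (m : ZMod R.d)))
      rw [lam, ← Finset.sum_neg_distrib] at h1
      rw [← h1]
      refine Finset.sum_congr rfl fun s _ => ?_
      rw [← br_neg]
      congr 1
      ring
    rw [hs, zero_smul, add_zero] at h
    exact h.symm

theorem big_isTriple {k : ZMod R.d} (hk : 2 * k ≠ 1) : IsTriple R bigE (bigF k) (bigK k) where
  e_pow := ext_big
    (fun m _ => by rw [bigE_pow_left, vec_of_le (by omega)]; rfl)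
    (fun m _ => by rw [bigE_pow_right, vec_of_le (by omega)]; rfl)
  f_pow := ext_big
    (fun m hm => by rw [bigF_pow_left, opF_pow_vec_of_lt (lam_d k) hm]; rfl)
    (fun m _ => by rw [bigF_pow_d hk]; rfl)
  k_pow := ext_big
    (fun m _ => by rw [bigK_pow_left, kw_pow_d, one_smul]; rfl)
    (fun m _ => by rw [bigK_pow_right, kw_pow_d, one_smul]; rfl)
  k_e := big_k_e k
  k_f := big_k_f k
  e_f := big_e_f k

/-- The `u_q`-module structure on `P_k ⊕ P_{1-k}` described above, of dimension `2 d`. -/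
def bigMod (k : ZMod R.d) (hk : 2 * k ≠ 1) : UqMod R where
  V := (Fin R.d → ℂ) × (Fin R.d → ℂ)
  ρ := Uq.lift (big_isTriple hk)

end Big

open Classical in
/-- The module `P̃_k`. If `2 k ≢ 1` modulo `d`, it is `P_k ⊕ P_{1-k}` with the action above. If
`2 k ≡ 1` modulo `d` (where `1 - k ≡ k`), it is `P_k` alone, with `F e_k^j = lam k j • e_k^(j-1)`. -/
def projMod (k : ZMod R.d) : UqMod R :=
  if hk : 2 * k = 1 then chain k R.d le_rfl (lam_d k) else bigMod k hk

end SmallQuantum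

end

open SmallQuantum

/-!
The tensor product `T` of two simple modules is graded by `deg (e_i^s ⊗ e_j^t) = s + t`, and the
degree `m` part has weight `i + j + m`. Writing out `E` and `F` in coordinates shows that `F` is
surjective onto the low degrees and kills a nonzero vector of each degree `l ≤ min u v`, that it is
injective in the high degrees, and that `E` is injective in the low degrees (`exists_gF_homog_eq`,
`exists_lowest`, `homog_eq_zero_of_gF`, `homog_eq_zero_of_gE`). Let `w` be a lowest weight vector of
degree `l`.

* If `l > e`, then `E ^ (u + v - 2 l + 1) w` has high degree and is killed by `F`, hence is zero, and
  `w` generates a simple module (`exists_simple_hom`).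
* If `2 l = e`, then `w` generates a copy of the simple module of dimension `d`.
* If `2 l < e`, put `a = e - 2 l - 1`. The vector `E ^ (a + 1) w` is nonzero and `E ^ a w = F x` for
  some `x`. As `w` and `x` satisfy the relations of `bigMod`, they give a homomorphism from it
  (`exists_big_hom_tensor`).

These homomorphisms are injective, since every nonzero submodule contains a weight vector killed
by `F` and such vectors are known explicitly in each summand (`chain_eq_of_gF_eq_zero`,
`big_eq_of_gF_eq_zero`). Their sum is injective because the weights of these vectors in the different
summands, `i + j + l` and `i + j + (e - l)` for `2 l ≤ e` and `i + j + l` for `l > e`, are distinct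
modulo `d` (`toModule_injective`, `coprod_injective`). The dimensions agree, so it is an isomorphism.

For the modules `projMod k` the main point is a universal property (`IsUniversal`): it has a
vector `z` of weight `m = 1 - k` with `(E F) ^ N z = 0`, where `N = 2`, or `N = 1` if `2 k = 1`,
and every vector of this kind in any module is the image of `z` under a homomorphism. On the
vectors of weight `m` the operator `E F` is annihilated by `∏ t < d, (X + lam (1 - m) t)`, for
which `0` is a root of multiplicity exactly `N`, so an element of `u_q` projects every module onto
the vectors of this kind (`exists_projection`). Hence these vectors lift along surjections, and
`projMod k` is projective. Moreover `(E F) ^ (N - 1) z` lies in every nonzero submodule; this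
gives indecomposability. Finally the module is isomorphic to its contragredient, by the universal
property applied to a functional, so that projectivity dualizes to injectivity.
-/

set_option linter.unusedSectionVars false

namespace SmallQuantum

variable {R : RootDatum}

/-! ### The scalars `kw` and `lam` -/

theorem RootDatum.sub_inv_ne_zero (R : RootDatum) : R.q - R.q⁻¹ ≠ 0 := by
  intro h
  have h1 : R.q ^ 2 = 1 := by
    have := R.q_ne_zero
    field_simp at h
    linear_combination h
  exact R.sq_prim.ne_one (by have := R.two_lt_d; omega) h1

theorem kw_injective : Function.Injective (kw : ZMod R.d → ℂ) := by
  intro i j h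
  unfold kw at h
  rw [pow_mul, pow_mul] at h
  exact ZMod.val_injective _ (R.sq_prim.pow_inj (ZMod.val_lt i) (ZMod.val_lt j) h)

/-- The closed form `lam i t = -[t] [2 i + t - 1]`, cleared of denominators. -/
theorem lam_closed_form (i : ZMod R.d) (t : ℕ) :
    lam i t * ((R.q - R.q⁻¹) * (kw i * kw (t : ZMod R.d) * (R.q ^ 2 - 1))) =
      -((kw (t : ZMod R.d) - 1) * (kw i ^ 2 * kw (t : ZMod R.d) - R.q ^ 2)) := by
  induction t with
  | zero => simp [lam_zero, kw_zero]
  | succ t ih =>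
    have hq := R.sub_inv_ne_zero
    have hi := kw_ne_zero i
    have ht := kw_ne_zero (t : ZMod R.d)
    have hb : br (i + (t : ZMod R.d)) * ((R.q - R.q⁻¹) * (kw i * kw (t : ZMod R.d)))
        = (kw i * kw (t : ZMod R.d)) ^ 2 - 1 := by
      rw [br, kw_add, div_mul_eq_mul_div, div_eq_iff hq]
      field_simp
    rw [lam_succ, Nat.cast_succ, kw_add, kw_one]
    linear_combination R.q ^ 2 * ih - R.q ^ 2 * (R.q ^ 2 - 1) * hb

theorem lam_eq_zero_iff {i : ZMod R.d} {t : ℕ} (h0 : 0 < t) (hd : t < R.d) :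
    lam i t = 0 ↔ (t : ZMod R.d) = 1 - 2 * i := by
  have h1 := lam_closed_form i t
  have hc : (R.q - R.q⁻¹) * (kw i * kw (t : ZMod R.d) * (R.q ^ 2 - 1)) ≠ 0 :=
    mul_ne_zero R.sub_inv_ne_zero (mul_ne_zero (mul_ne_zero (kw_ne_zero _) (kw_ne_zero _))
      (sub_ne_zero.mpr (R.sq_prim.ne_one (by have := R.two_lt_d; omega))))
  have ht : kw (t : ZMod R.d) - 1 ≠ 0 := by
    rw [kw_natCast, pow_mul]
    exact sub_ne_zero.mpr (R.sq_prim.pow_ne_one_of_pos_of_lt (by omega) hd)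
  rw [← mul_eq_zero_iff_right hc, h1, neg_eq_zero, mul_eq_zero_iff_left ht, sub_eq_zero, sq,
    ← kw_add, ← kw_add, ← kw_one, kw_injective.eq_iff]
  constructor <;> intro h <;> linear_combination h

theorem natCast_inj_of_lt {m n : ℕ} (hm : m < R.d) (hn : n < R.d)
    (h : (m : ZMod R.d) = (n : ZMod R.d)) : m = n := by
  rw [ZMod.natCast_eq_natCast_iff'] at h
  rwa [Nat.mod_eq_of_lt hm, Nat.mod_eq_of_lt hn] at h

theorem IsSimplePair.lam_ne_zero {i : ZMod R.d} {u t : ℕ} (h : IsSimplePair i u) (h0 : 0 < t)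
    (ht : t ≤ u) : lam i t ≠ 0 := by
  have hu := h.1
  rw [Ne, lam_eq_zero_iff h0 (by omega)]
  intro h1
  have h2 : ((t - 1 : ℕ) : ZMod R.d) = (u : ZMod R.d) := by
    rw [h.2, Nat.cast_sub h0, h1]
    push_cast
    ring
  have := natCast_inj_of_lt (by omega) hu h2
  omega

/-! ### Weight vectors in a `u_q`-module -/

/-- The generator `E` of `u_q`. -/
abbrev gE : Uq R := Uq.gen R Gen.E

/-- The generator `F` of `u_q`. -/
abbrev gF : Uq R := Uq.gen R Gen.F

/-- The generator `K` of `u_q`. -/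
abbrev gK : Uq R := Uq.gen R Gen.K

theorem Uq.induction {P : Uq R → Prop} (hc : ∀ c : ℂ, P (algebraMap ℂ (Uq R) c))
    (hg : ∀ g, P (Uq.gen R g)) (hm : ∀ a b, P a → P b → P (a * b))
    (ha : ∀ a b, P a → P b → P (a + b)) (a : Uq R) : P a := by
  let φ : FreeAlgebra ℂ Gen →ₐ[ℂ] Uq R := RingQuot.mkAlgHom ℂ (Rel R)
  obtain ⟨a, rfl⟩ : ∃ b, φ b = a := RingQuot.mkAlgHom_surjective ℂ (Rel R) a
  induction a using FreeAlgebra.induction with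
  | grade0 c => rw [AlgHom.commutes]; exact hc c
  | grade1 g => exact hg g
  | mul a b h h' => rw [map_mul]; exact hm _ _ h h'
  | add a b h h' => rw [map_add]; exact ha _ _ h h'

instance UqMod.isScalarTower (X : UqMod R) : IsScalarTower ℂ (Uq R) X :=
  ⟨fun c a x => by simp only [UqMod.smul_def, map_smul, LinearMap.smul_apply]⟩

section Weights

variable {X : Type*} [AddCommGroup X] [Module ℂ X] [Module (Uq R) X] [IsScalarTower ℂ (Uq R) X]
  {Y : Type*} [AddCommGroup Y] [Module ℂ Y] [Module (Uq R) Y] [IsScalarTower ℂ (Uq R) Y]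

/-- A `ℂ`-linear map that commutes with the generators is `u_q`-linear. -/
def homOfGen (f : X →ₗ[ℂ] Y) (hE : ∀ x, f ((gE : Uq R) • x) = (gE : Uq R) • f x)
    (hF : ∀ x, f ((gF : Uq R) • x) = (gF : Uq R) • f x)
    (hK : ∀ x, f ((gK : Uq R) • x) = (gK : Uq R) • f x) : X →ₗ[Uq R] Y where
  toFun := f
  map_add' := map_add f
  map_smul' a := by
    induction a using Uq.induction with
    | hc c => intro x; simp [algebraMap_smul]
    | hg g =>
      intro x
      cases g
      · exact hE x
      · exact hF x
      · exact hK x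
    | hm a b ha hb =>
      intro x
      have h := ha (b • x)
      simp only [RingHom.id_apply] at h hb ⊢
      rw [mul_smul, h, hb, mul_smul]
    | ha a b ha hb =>
      intro x
      simp only [RingHom.id_apply] at ha hb ⊢
      rw [add_smul, map_add, ha, hb, add_smul]

variable (R) in
/-- The vectors of weight `m`, on which `K` acts by `q ^ (2 m)`. -/
def Wt (m : ZMod R.d) (x : X) : Prop := (gK : Uq R) • x = kw m • x

theorem gE_pow_d (x : X) : (gE : Uq R) ^ R.d • x = 0 := by
  rw [(Uq.isTriple R).e_pow, zero_smul]

theorem gF_pow_d (x : X) : (gF : Uq R) ^ R.d • x = 0 := by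
  rw [(Uq.isTriple R).f_pow, zero_smul]

theorem Wt.smul {m : ZMod R.d} {x : X} (h : Wt R m x) (c : ℂ) : Wt R m (c • x) := by
  unfold Wt at *
  rw [smul_comm, h, smul_comm]

theorem Wt.add {m : ZMod R.d} {x y : X} (h : Wt R m x) (h' : Wt R m y) : Wt R m (x + y) := by
  unfold Wt at *
  rw [smul_add, h, h', smul_add]

theorem Wt.map {m : ZMod R.d} {x : X} (h : Wt R m x) (f : X →ₗ[Uq R] Y) : Wt R m (f x) := by
  unfold Wt at *
  rw [← map_smul, h, LinearMap.map_smul_of_tower]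

theorem Wt.raise {m : ZMod R.d} {x : X} (h : Wt R m x) : Wt R (m + 1) ((gE : Uq R) • x) := by
  unfold Wt at *
  rw [← mul_smul, (Uq.isTriple R).k_e, smul_assoc, mul_smul, h, kw_add, kw_one, smul_comm _ (kw m),
    smul_smul, mul_comm]

theorem Wt.lower {m : ZMod R.d} {x : X} (h : Wt R m x) : Wt R (m - 1) ((gF : Uq R) • x) := by
  unfold Wt at *
  rw [← mul_smul, (Uq.isTriple R).k_f, smul_assoc, mul_smul, h, sub_eq_add_neg, kw_add, kw_neg,
    kw_one, smul_comm _ (kw m), smul_smul, mul_comm]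

theorem Wt.raise_pow {m : ZMod R.d} {x : X} (h : Wt R m x) (t : ℕ) :
    Wt R (m + t) ((gE : Uq R) ^ t • x) := by
  induction t with
  | zero => simpa using h
  | succ t ih =>
    rw [pow_succ', mul_smul, Nat.cast_succ, ← add_assoc]
    exact ih.raise

theorem Wt.lower_pow {m : ZMod R.d} {x : X} (h : Wt R m x) (t : ℕ) :
    Wt R (m - t) ((gF : Uq R) ^ t • x) := by
  induction t with
  | zero => simpa using h
  | succ t ih =>
    rw [pow_succ', mul_smul, Nat.cast_succ, ← sub_sub]
    exact ih.lower

theorem Wt.K_pow {m : ZMod R.d} {x : X} (h : Wt R m x) (t : ℕ) :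
    (gK : Uq R) ^ t • x = kw m ^ t • x := by
  induction t with
  | zero => simp
  | succ t ih => rw [pow_succ, mul_smul, h, smul_comm, ih, smul_smul, pow_succ']

theorem Wt.E_F {m : ZMod R.d} {x : X} (h : Wt R m x) :
    (gE : Uq R) • (gF : Uq R) • x
      = (gF : Uq R) • (gE : Uq R) • x + br m • x := by
  rw [← mul_smul, ← mul_smul, ← sub_eq_iff_eq_add', ← sub_smul, (Uq.isTriple R).e_f, smul_assoc,
    sub_smul, h.K_pow, kw_pow_pred, br, div_eq_inv_mul, mul_smul, sub_smul]
  congr 2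

theorem Wt.F_E_pow {m : ZMod R.d} {x : X} (h : Wt R m x) (t : ℕ) :
    (gF : Uq R) • (gE : Uq R) ^ t • x
      = (gE : Uq R) ^ t • (gF : Uq R) • x
        + lam m t • (gE : Uq R) ^ (t - 1) • x := by
  induction t with
  | zero => simp [lam_zero]
  | succ t ih =>
    have h1 := (h.raise_pow t).E_F
    rw [ih, smul_add, smul_comm (gE : Uq R) (lam m t)] at h1
    rw [pow_succ', mul_smul, ← sub_eq_iff_eq_add.mpr h1, lam_succ, sub_smul, mul_smul,
      Nat.add_sub_cancel]
    cases t with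
    | zero => simp [lam_zero, sub_eq_add_neg]
    | succ t =>
      rw [Nat.add_sub_cancel, ← mul_smul _ (gE ^ t : Uq R), ← pow_succ']
      abel

/-- Moving `E` past a power of `F`: the operator `E F` on the weight space of `x`, shifted by a
scalar that depends only on the weight and the exponent. -/
theorem Wt.E_F_pow_succ {m : ZMod R.d} {x : X} (h : Wt R m x) (t : ℕ) :
    (gE : Uq R) • (gF : Uq R) ^ (t + 1) • x
      = (gF : Uq R) ^ t •
        ((gE : Uq R) • (gF : Uq R) • x + lam (1 - m) t • x) := by
  induction t with
  | zero => simp [lam_zero]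
  | succ t ih =>
    have h1 := (h.lower_pow (t + 1)).E_F
    have h2 : lam (1 - m) (t + 1) = lam (1 - m) t + br (m - ((t + 1 : ℕ) : ZMod R.d)) := by
      rw [lam_succ, ← neg_neg (br (m - _)), ← br_neg, sub_eq_add_neg]
      congr 3
      push_cast
      ring
    rw [pow_succ', mul_smul, h1, ih, h2, add_smul, ← add_assoc, pow_succ', mul_smul, mul_smul]
    simp only [smul_add, smul_comm _ (br _)]

/-- If `E F v = 0`, then `F ^ t v = 0` can be lowered to `F ^ r v = 0` as long as the scalars met on
the way do not vanish. -/
theorem Wt.lower_descend {m : ZMod R.d} {v : X} (h : Wt R m v)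
    (h0 : (gE : Uq R) • (gF : Uq R) • v = 0) {r t : ℕ} (hrt : r ≤ t)
    (ht : (gF : Uq R) ^ t • v = 0)
    (hl : ∀ s, r ≤ s → s < t → lam (1 - m) s ≠ 0) : (gF : Uq R) ^ r • v = 0 := by
  induction t, hrt using Nat.le_induction with
  | base => exact ht
  | succ t hrt ih =>
    refine ih ?_ fun s h1 h2 => hl s h1 (by omega)
    have h1 := h.E_F_pow_succ t
    rw [ht, smul_zero, h0, zero_add, smul_comm] at h1
    exact (smul_eq_zero.mp h1.symm).resolve_left (hl t hrt (by omega))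

theorem Wt.prod_eq_zero {m : ZMod R.d} {x : X} (h : Wt R m x) :
    (∏ s ∈ Finset.range R.d, (Polynomial.X + Polynomial.C (lam (1 - m) s))).aeval
      ((gE : Uq R) * gF) • x = 0 := by
  have key : ∀ t : ℕ, ∀ y : X, Wt R m y →
      (∏ s ∈ Finset.range t, (Polynomial.X + Polynomial.C (lam (1 - m) s))).aeval
        ((gE : Uq R) * gF) • y
      = (gE : Uq R) ^ t • (gF : Uq R) ^ t • y := by
    intro t
    induction t with
    | zero => simp
    | succ t ih =>
      intro y hy
      have h1 : Wt R m ((gE : Uq R) • (gF : Uq R) • y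
          + lam (1 - m) t • y) := by
        have := hy.lower.raise
        rw [sub_add_cancel] at this
        exact this.add (hy.smul _)
      rw [Finset.prod_range_succ, map_mul, mul_smul, pow_succ, mul_smul, hy.E_F_pow_succ, ← ih _ h1]
      congr 1
      simp [add_smul, mul_smul, algebraMap_smul]
  rw [key _ _ h, gF_pow_d, smul_zero]

end Weights

/-! ### Projections in `u_q` and lowest weight vectors -/

section Projection

variable {X : Type*} [AddCommGroup X] [Module ℂ X] [Module (Uq R) X] [IsScalarTower ℂ (Uq R) X]
  {Y : Type*} [AddCommGroup Y] [Module ℂ Y] [Module (Uq R) Y] [IsScalarTower ℂ (Uq R) Y]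

/-- The projection onto the vectors of weight `m`, as an element of `u_q`. -/
noncomputable def wproj (m : ZMod R.d) : Uq R :=
  (R.d : ℂ)⁻¹ • ∑ t ∈ Finset.range R.d, (kw (-m) • (gK : Uq R)) ^ t

theorem wt_wproj (m : ZMod R.d) (x : X) : Wt R m (wproj m • x) := by
  have h1 := mul_geom_sum (kw (-m) • (gK : Uq R)) R.d
  rw [smul_pow, (Uq.isTriple R).k_pow, kw_pow_d, one_smul, sub_self, sub_mul, one_mul,
    sub_eq_zero, smul_mul_assoc, kw_neg, inv_smul_eq_iff₀ (kw_ne_zero m)] at h1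
  unfold Wt wproj
  rw [← mul_smul, mul_smul_comm, kw_neg, h1, smul_comm, smul_assoc (kw m)]

theorem wproj_smul_of_wt {m : ZMod R.d} {x : X} (h : Wt R m x) : wproj m • x = x := by
  have h1 : ∀ t : ℕ, (kw (-m) • (gK : Uq R)) ^ t • x = x := by
    intro t
    rw [smul_pow, smul_assoc, h.K_pow, smul_smul, ← mul_pow, ← kw_add, neg_add_cancel, kw_zero,
      one_pow, one_smul]
  have hd : (R.d : ℂ) ≠ 0 := Nat.cast_ne_zero.mpr (NeZero.ne _)
  rw [wproj, smul_assoc, Finset.sum_smul, Finset.sum_congr rfl fun t _ => h1 t, Finset.sum_const,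
    Finset.card_range, ← Nat.cast_smul_eq_nsmul ℂ, inv_smul_smul₀ hd]

theorem Wt.aeval {m : ZMod R.d} {x : X} (h : Wt R m x) (p : Polynomial ℂ) :
    Wt R m (p.aeval ((gE : Uq R) * gF) • x) := by
  have hp : ∀ t : ℕ, Wt R m (((gE : Uq R) * gF) ^ t • x) := by
    intro t
    induction t with
    | zero => simpa using h
    | succ t ih =>
      have := ih.lower.raise
      rw [sub_add_cancel] at this
      rwa [pow_succ', mul_smul, mul_smul]
  induction p using Polynomial.induction_on' with
  | add p p' hp hp' => rw [map_add, add_smul]; exact hp.add hp'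
  | monomial t c =>
    rw [Polynomial.aeval_monomial, mul_smul, algebraMap_smul]
    exact (hp t).smul c

/-- The vectors of weight `m` killed by `(E F) ^ N`. -/
def IsGen (m : ZMod R.d) (N : ℕ) (x : X) : Prop :=
  Wt R m x ∧ ((gE : Uq R) * gF) ^ N • x = 0

theorem IsGen.map {m : ZMod R.d} {N : ℕ} {x : X} (h : IsGen m N x) (f : X →ₗ[Uq R] Y) :
    IsGen m N (f x) :=
  ⟨h.1.map f, by rw [← map_smul, h.2, map_zero]⟩

/-- On a weight space `E F` is annihilated by an explicit polynomial with `N` roots equal to `0`, so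
the projection onto the generalized eigenspace for the eigenvalue `0` is given by an element of
`u_q`. -/
theorem exists_projection {m : ZMod R.d} {N : ℕ}
    (hN : ((Finset.range R.d).filter fun s => lam (1 - m) s = 0).card = N) :
    ∃ π : Uq R, ∀ (X : Type) [AddCommGroup X] [Module ℂ X] [Module (Uq R) X]
      [IsScalarTower ℂ (Uq R) X] (x : X), IsGen m N (π • x) ∧ (IsGen m N x → π • x = x) := by
  set g : Polynomial ℂ := ∏ s ∈ (Finset.range R.d).filter (fun s => ¬ lam (1 - m) s = 0),
    (Polynomial.X + Polynomial.C (lam (1 - m) s)) with hg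
  have hp : ∏ s ∈ Finset.range R.d, (Polynomial.X + Polynomial.C (lam (1 - m) s))
      = Polynomial.X ^ N * g := by
    rw [← Finset.prod_filter_mul_prod_filter_not _ (fun s => lam (1 - m) s = 0), ← hg]
    congr 1
    rw [← hN, ← Finset.prod_const]
    refine Finset.prod_congr rfl fun s hs => ?_
    rw [(Finset.mem_filter.mp hs).2, map_zero, add_zero]
  have hc : IsCoprime (Polynomial.X ^ N) g := by
    refine IsCoprime.pow_left (IsCoprime.prod_right fun s hs => ?_)
    refine ⟨-Polynomial.C (lam (1 - m) s)⁻¹, Polynomial.C (lam (1 - m) s)⁻¹, ?_⟩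
    rw [mul_add, ← add_assoc, neg_mul, neg_add_cancel, zero_add, ← map_mul,
      inv_mul_cancel₀ (Finset.mem_filter.mp hs).2, map_one]
  obtain ⟨a, b, hab⟩ := hc
  refine ⟨(b * g).aeval ((gE : Uq R) * gF) * wproj m, ?_⟩
  intro X _ _ _ _ x
  have hw := wt_wproj m x
  refine ⟨⟨?_, ?_⟩, fun h => ?_⟩
  · rw [mul_smul]
    exact hw.aeval _
  · have h1 := hw.prod_eq_zero
    rw [hp] at h1
    have h2 : ((gE : Uq R) * gF) ^ N = (Polynomial.X ^ N : Polynomial ℂ).aeval ((gE : Uq R) * gF) := by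
      simp
    rw [mul_smul, h2, ← mul_smul, ← map_mul, show Polynomial.X ^ N * (b * g)
      = b * (Polynomial.X ^ N * g) by ring, map_mul, mul_smul, h1, smul_zero]
  · have h1 : b * g = 1 - a * Polynomial.X ^ N := by rw [← hab]; ring
    rw [mul_smul, wproj_smul_of_wt h.1, h1, map_sub, map_one, sub_smul, one_smul, map_mul, mul_smul,
      map_pow, Polynomial.aeval_X, h.2, smul_zero, sub_zero]

/-- Every nonzero submodule contains a nonzero weight vector killed by `F`. -/
theorem exists_lowest_weight {S : Submodule (Uq R) X} (hS : S ≠ ⊥) :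
    ∃ y ∈ S, y ≠ 0 ∧ (gF : Uq R) • y = 0 ∧ ∃ m, Wt R m y := by
  obtain ⟨x, hxS, hx⟩ := S.exists_mem_ne_zero_of_ne_bot hS
  obtain ⟨m, hm⟩ : ∃ m : ZMod R.d, wproj m • x ≠ 0 := by
    by_contra! h
    -- the projections `wproj m` add up to `1`, by orthogonality of the characters `m ↦ kw m ^ t`
    have hsum : ∀ t ∈ Finset.range R.d, t ≠ 0 → ∑ m : ZMod R.d, kw (-m) ^ t = 0 := by
      intro t ht h0
      have h1 : ∑ m : ZMod R.d, kw (-m) ^ t = kw (1 : ZMod R.d) ^ t * ∑ m : ZMod R.d, kw (-m) ^ t := by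
        rw [Finset.mul_sum]
        refine Fintype.sum_equiv (Equiv.addRight 1) _ _ fun m => ?_
        rw [← mul_pow, ← kw_add, Equiv.coe_addRight]
        congr 2
        ring
      have h2 : kw (1 : ZMod R.d) ^ t ≠ 1 := by
        rw [kw_one]
        exact R.sq_prim.pow_ne_one_of_pos_of_lt h0 (Finset.mem_range.mp ht)
      by_contra h3
      exact h2 (mul_right_cancel₀ h3 (h1.symm.trans (one_mul _).symm))
    have h1 : ∑ m : ZMod R.d, wproj m = (1 : Uq R) := by
      simp only [wproj, smul_pow]
      rw [← Finset.smul_sum, Finset.sum_comm]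
      simp only [← Finset.sum_smul]
      rw [Finset.sum_eq_single 0 (fun t ht h0 => by rw [hsum t ht h0, zero_smul])
        (fun h => absurd (Finset.mem_range.mpr (Nat.pos_of_ne_zero (NeZero.ne R.d))) h)]
      simp [ZMod.card, smul_smul]
    exact hx (by rw [← one_smul (Uq R) x, ← h1, Finset.sum_smul, Finset.sum_eq_zero fun m _ => h m])
  have hw := wt_wproj m x
  set y := wproj m • x
  have hyS : y ∈ S := S.smul_mem _ hxS
  classical
  have hex : ∃ t, (gF : Uq R) ^ t • y = 0 := ⟨R.d, gF_pow_d y⟩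
  have hpos : Nat.find hex ≠ 0 := fun h => hm (by simpa [h] using Nat.find_spec hex)
  obtain ⟨t, ht⟩ := Nat.exists_eq_succ_of_ne_zero hpos
  refine ⟨(gF : Uq R) ^ t • y, S.smul_mem _ hyS, Nat.find_min hex (by omega), ?_, _, hw.lower_pow t⟩
  have := Nat.find_spec hex
  rwa [ht, Nat.succ_eq_add_one, pow_succ', mul_smul] at this

end Projection

/-! ### Contragredient modules -/

section Dual

variable {X : Type} [AddCommGroup X] [Module ℂ X] [Module (Uq R) X] [IsScalarTower ℂ (Uq R) X]
  {Y : Type} [AddCommGroup Y] [Module ℂ Y] [Module (Uq R) Y] [IsScalarTower ℂ (Uq R) Y]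

variable (R X) in
theorem dual_isTriple : IsTriple R
    (A := Module.End ℂ (Module.Dual ℂ X))
    (Algebra.lsmul ℂ ℂ X (gF : Uq R)).dualMap (Algebra.lsmul ℂ ℂ X (gE : Uq R)).dualMap
    (Algebra.lsmul ℂ ℂ X (gK : Uq R)).dualMap := by
  have hpow : ∀ (a : Uq R) (t : ℕ) (φ : Module.Dual ℂ X) (x : X),
      (((Algebra.lsmul ℂ ℂ X a).dualMap : Module.End ℂ (Module.Dual ℂ X)) ^ t) φ x
        = φ (a ^ t • x) := by
    intro a t
    induction t with
    | zero => intro φ x; simp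
    | succ t ih => intro φ x; rw [pow_succ', Module.End.mul_apply]; simp [ih, pow_succ, mul_smul]
  have hq : R.q ^ 2 ≠ 0 := pow_ne_zero _ R.q_ne_zero
  constructor
  · ext φ x
    rw [hpow, gF_pow_d]; simp
  · ext φ x
    rw [hpow, gE_pow_d]; simp
  · ext φ x
    rw [hpow, (Uq.isTriple R).k_pow]; simp
  · ext φ x
    have := congrArg (fun a => φ (a • x)) (Uq.isTriple R).k_f
    simp only [smul_assoc, map_smul, mul_smul] at this
    simp [this, hq]
  · ext φ x
    have := congrArg (fun a => φ (a • x)) (Uq.isTriple R).k_e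
    simp only [smul_assoc, map_smul, mul_smul] at this
    simp [this, hq]
  · ext φ x
    have := congrArg (fun a => φ (a • x)) (Uq.isTriple R).e_f
    simp only [smul_assoc, map_smul, mul_smul, sub_smul, map_sub] at this
    simp [hpow, this]

variable (R X) in
/-- The contragredient of a `u_q`-module: the dual vector space, on which `E`, `F`, `K` act by the
transposes of `F`, `E`, `K`. -/
noncomputable def dual : UqMod R where
  V := Module.Dual ℂ X
  ρ := Uq.lift (dual_isTriple R X)

variable (R X) in
/-- The underlying space of the contragredient is the dual space. -/
def dualEquiv : dual R X ≃ₗ[ℂ] Module.Dual ℂ X := LinearEquiv.refl ℂ (Module.Dual ℂ X)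

theorem dual_gE (φ : dual R X) (x : X) :
    dualEquiv R X ((gE : Uq R) • φ) x = dualEquiv R X φ ((gF : Uq R) • x) := by
  have := Uq.lift_E (dual_isTriple R X)
  exact LinearMap.congr_fun (LinearMap.congr_fun this φ) x

theorem dual_gF (φ : dual R X) (x : X) :
    dualEquiv R X ((gF : Uq R) • φ) x = dualEquiv R X φ ((gE : Uq R) • x) := by
  have := Uq.lift_F (dual_isTriple R X)
  exact LinearMap.congr_fun (LinearMap.congr_fun this φ) x

theorem dual_gK (φ : dual R X) (x : X) :
    dualEquiv R X ((gK : Uq R) • φ) x = dualEquiv R X φ ((gK : Uq R) • x) := by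
  have := Uq.lift_K (dual_isTriple R X)
  exact LinearMap.congr_fun (LinearMap.congr_fun this φ) x

theorem dual_EF_pow (t : ℕ) (φ : dual R X) (x : X) :
    dualEquiv R X (((gE : Uq R) * gF) ^ t • φ) x
      = dualEquiv R X φ (((gE : Uq R) * gF) ^ t • x) := by
  induction t generalizing x with
  | zero => simp
  | succ t ih =>
    rw [pow_succ', mul_smul, mul_smul, dual_gE, dual_gF, ih, ← pow_succ', pow_succ, mul_smul, mul_smul]

theorem dual_ext {φ ψ : dual R X} (h : ∀ x, dualEquiv R X φ x = dualEquiv R X ψ x) : φ = ψ :=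
  (dualEquiv R X).injective (LinearMap.ext h)

/-- The transpose of a homomorphism. -/
noncomputable def dualHom (f : X →ₗ[Uq R] Y) : dual R Y →ₗ[Uq R] dual R X :=
  homOfGen ((dualEquiv R X).symm.toLinearMap ∘ₗ (f.restrictScalars ℂ).dualMap ∘ₗ
      (dualEquiv R Y).toLinearMap)
    (fun φ => dual_ext fun x => by simp [dual_gE])
    (fun φ => dual_ext fun x => by simp [dual_gF])
    (fun φ => dual_ext fun x => by simp [dual_gK])

theorem dualHom_surjective {f : X →ₗ[Uq R] Y} (hf : Function.Injective f) :
    Function.Surjective (dualHom f) := by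
  intro φ
  obtain ⟨ψ, hψ⟩ := LinearMap.dualMap_surjective_of_injective
    (f := f.restrictScalars ℂ) hf (dualEquiv R X φ)
  exact ⟨(dualEquiv R Y).symm ψ, (dualEquiv R X).injective hψ⟩

/-- A homomorphism `X → Yᵛ` is a contravariant pairing, hence also a homomorphism `Y → Xᵛ`. -/
noncomputable def flipHom (f : X →ₗ[Uq R] dual R Y) : Y →ₗ[Uq R] dual R X :=
  homOfGen ((dualEquiv R X).symm.toLinearMap ∘ₗ
      ((dualEquiv R Y).toLinearMap ∘ₗ f.restrictScalars ℂ).flip)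
    (fun y => dual_ext fun x => by simp [dual_gE, dual_gF])
    (fun y => dual_ext fun x => by simp [dual_gF, dual_gE])
    (fun y => dual_ext fun x => by simp [dual_gK])

theorem flipHom_apply (f : X →ₗ[Uq R] dual R Y) (x : X) (y : Y) :
    dualEquiv R X (flipHom f y) x = dualEquiv R Y (f x) y := rfl

end Dual

/-! ### Modules with a universal generator -/

/-- `z` is a universal vector of weight `m` killed by `(E F) ^ N`, where `N` is the multiplicity of
the root `0` of the polynomial that annihilates `E F` on the weight spaces of weight `m`; moreover
`(E F) ^ (N - 1) z` lies in every nonzero submodule, and is not killed by some functional of the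
same kind as `z`. -/
structure IsUniversal (P : UqMod R) (m : ZMod R.d) (N : ℕ) (z : P) : Prop where
  card : ((Finset.range R.d).filter fun s => lam (1 - m) s = 0).card = N
  isGen : IsGen m N z
  lift : ∀ (X : Type) [AddCommGroup X] [Module ℂ X] [Module (Uq R) X]
      [IsScalarTower ℂ (Uq R) X] (x : X), IsGen m N x → ∃ f : P →ₗ[Uq R] X, f z = x
  socle : ∀ S : Submodule (Uq R) P, S ≠ ⊥ → ((gE : Uq R) * gF) ^ (N - 1) • z ∈ S
  dual : ∃ ζ : dual R P, IsGen m N ζ ∧ dualEquiv R P ζ (((gE : Uq R) * gF) ^ (N - 1) • z) ≠ 0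

namespace IsUniversal

variable {P : UqMod R} {m : ZMod R.d} {N : ℕ} {z : P}

theorem socle_ne_zero (h : IsUniversal P m N z) : ((gE : Uq R) * gF) ^ (N - 1) • z ≠ 0 := by
  intro h0
  obtain ⟨ζ, -, hζ⟩ := h.dual
  exact hζ (by rw [h0, map_zero])

theorem injective_of_ne_zero (h : IsUniversal P m N z) {X : Type*} [AddCommGroup X] [Module (Uq R) X]
    (f : P →ₗ[Uq R] X) (hf : ((gE : Uq R) * gF) ^ (N - 1) • f z ≠ 0) : Function.Injective f := by
  rw [← LinearMap.ker_eq_bot]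
  by_contra hk
  have := h.socle _ hk
  rw [LinearMap.mem_ker, map_smul] at this
  exact hf this

theorem isIndecomposable (h : IsUniversal P m N z) : IsIndecomposable (Uq R) P := by
  refine ⟨⟨_, _, h.socle_ne_zero⟩, fun S S' hS => ?_⟩
  by_contra! hn
  exact h.socle_ne_zero ((Submodule.disjoint_def.mp hS.disjoint) _ (h.socle _ hn.1) (h.socle _ hn.2))

theorem projective [FiniteDimensional ℂ P] (h : IsUniversal P m N z) :
    Module.Projective (Uq R) P := by
  refine Module.Projective.of_lifting_property'' fun f hf => ?_
  obtain ⟨π, hπ⟩ := exists_projection h.card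
  obtain ⟨y, hy⟩ := hf z
  obtain ⟨g, hg⟩ := h.lift _ (π • y) (hπ _ y).1
  have h1 : (f ∘ₗ g) z = z := by
    rw [LinearMap.comp_apply, hg, map_smul, hy, (hπ _ z).2 h.isGen]
  have hinj : Function.Injective (f ∘ₗ g) :=
    h.injective_of_ne_zero _ (by rw [h1]; exact h.socle_ne_zero)
  have hsurj : Function.Surjective (f ∘ₗ g) :=
    LinearMap.surjective_of_injective (f := (f ∘ₗ g).restrictScalars ℂ) hinj
  let e : P ≃ₗ[Uq R] P := LinearEquiv.ofBijective (f ∘ₗ g) ⟨hinj, hsurj⟩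
  refine ⟨g ∘ₗ e.symm.toLinearMap, LinearMap.ext fun x => ?_⟩
  exact e.apply_symm_apply x

theorem injective [FiniteDimensional ℂ P] (h : IsUniversal P m N z) :
    Module.Injective (Uq R) P := by
  constructor
  intro X Y _ _ _ _ f hf g
  let _ : Module ℂ X := Module.compHom X (algebraMap ℂ (Uq R))
  let _ : Module ℂ Y := Module.compHom Y (algebraMap ℂ (Uq R))
  have : IsScalarTower ℂ (Uq R) X := IsScalarTower.of_algebraMap_smul fun c x => rfl
  have : IsScalarTower ℂ (Uq R) Y := IsScalarTower.of_algebraMap_smul fun c x => rfl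
  obtain ⟨ζ, hζ, hζ0⟩ := h.dual
  obtain ⟨θ, hθ⟩ := h.lift _ ζ hζ
  have hθi : Function.Injective θ := by
    refine h.injective_of_ne_zero _ fun h0 => hζ0 ?_
    rw [hθ] at h0
    rw [← dual_EF_pow, h0, map_zero, LinearMap.zero_apply]
  have hfr : Module.finrank ℂ P = Module.finrank ℂ (SmallQuantum.dual R P) :=
    (Subspace.dual_finrank_eq (K := ℂ) (V := P)).symm.trans (dualEquiv R P).finrank_eq.symm
  have : FiniteDimensional ℂ (SmallQuantum.dual R P) :=
    (dualEquiv R P).symm.finiteDimensional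
  have hθs : Function.Surjective θ := (LinearMap.injective_iff_surjective_of_finrank_eq_finrank
    (f := θ.restrictScalars ℂ) hfr).mp hθi
  have hFi : Function.Injective (flipHom θ) := by
    rw [injective_iff_map_eq_zero]
    intro p hp
    refine (Module.forall_dual_apply_eq_zero_iff ℂ p).mp fun φ => ?_
    obtain ⟨p', hp'⟩ := hθs ((dualEquiv R P).symm φ)
    have h1 : dualEquiv R P (flipHom θ p) p' = 0 := by rw [hp, map_zero, LinearMap.zero_apply]
    rw [flipHom_apply, hp', LinearEquiv.apply_symm_apply] at h1
    exact h1
  have hFs : Function.Surjective (flipHom θ) :=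
    (LinearMap.injective_iff_surjective_of_finrank_eq_finrank
      (f := (flipHom θ).restrictScalars ℂ) hfr).mp hFi
  have := h.projective
  obtain ⟨k, hk⟩ := Module.projective_lifting_property (dualHom f) (dualHom g ∘ₗ θ)
    (dualHom_surjective hf)
  let e := LinearEquiv.ofBijective (flipHom θ) ⟨hFi, hFs⟩
  refine ⟨e.symm.toLinearMap ∘ₗ flipHom k, fun x => ?_⟩
  rw [LinearMap.comp_apply, LinearEquiv.coe_coe, LinearEquiv.symm_apply_eq]
  refine dual_ext fun p => ?_
  have h1 := congrArg (fun φ => dualEquiv R X φ x) (LinearMap.congr_fun hk p)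
  exact h1

end IsUniversal

/-! ### The modules `chain` -/

theorem lsmul_apply {X : Type*} [AddCommGroup X] [Module ℂ X] [Module (Uq R) X]
    [IsScalarTower ℂ (Uq R) X] (a : Uq R) (x : X) : Algebra.lsmul ℂ ℂ X a x = a • x := rfl

/-- The `t`-th coordinate on `ℂ^N`, which is zero for `t ≥ N`. -/
noncomputable def coord (N t : ℕ) : (Fin N → ℂ) →ₗ[ℂ] ℂ := onVec N fun j => if j = t then 1 else 0

theorem coord_vec (N t m : ℕ) : coord N t (vec N m) = if m = t ∧ m < N then 1 else 0 := by
  rcases Nat.lt_or_ge m N with h | h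
  · rw [coord, onVec_vec _ h]
    simp [h]
  · rw [vec_of_le h, map_zero, if_neg (by omega)]

theorem sum_coord {N : ℕ} (x : Fin N → ℂ) : x = ∑ t ∈ Finset.range N, coord N t x • vec N t := by
  have h : (LinearMap.id : (Fin N → ℂ) →ₗ[ℂ] _)
      = ∑ t ∈ Finset.range N, (coord N t).smulRight (vec N t) := by
    refine ext_vec fun m hm => ?_
    rw [LinearMap.sum_apply, Finset.sum_eq_single m]
    · simp [coord_vec, hm]
    · intro t _ ht
      simp [coord_vec, ht.symm]
    · intro h
      exact absurd (Finset.mem_range.mpr hm) h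
  simpa using LinearMap.congr_fun h x

theorem coord_opF {i : ZMod R.d} {N : ℕ} (hN : lam i N = 0) (t : ℕ) (x : Fin N → ℂ) :
    coord N t (opF i N x) = lam i (t + 1) * coord N (t + 1) x := by
  have h : coord N t ∘ₗ opF i N = lam i (t + 1) • coord N (t + 1) := by
    refine ext_vec fun m hm => ?_
    rw [LinearMap.comp_apply, opF_vec hN, map_smul, LinearMap.smul_apply, coord_vec, coord_vec]
    cases m with
    | zero => simp [lam_zero]
    | succ m =>
      by_cases h : m = t
      · subst h
        simp [hm, Nat.lt_of_succ_lt hm]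
      · simp [h]
  simpa using LinearMap.congr_fun h x

section Chain

variable {i : ZMod R.d} {N : ℕ} (hd : N ≤ R.d) (hN : lam i N = 0)

/-- The vector space underlying `chain`. -/
noncomputable def chainEquiv : chain i N hd hN ≃ₗ[ℂ] (Fin N → ℂ) := LinearEquiv.refl ℂ (Fin N → ℂ)

instance chain_finiteDimensional : FiniteDimensional ℂ (chain i N hd hN) :=
  (chainEquiv hd hN).symm.finiteDimensional

theorem finrank_chain : Module.finrank ℂ (chain i N hd hN) = N := by
  rw [(chainEquiv hd hN).finrank_eq, Module.finrank_fin_fun]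

theorem chain_gE (x : chain i N hd hN) :
    chainEquiv hd hN ((gE : Uq R) • x) = opE N (chainEquiv hd hN x) :=
  LinearMap.congr_fun (Uq.lift_E (chain_isTriple hd hN)) x

theorem chain_gF (x : chain i N hd hN) :
    chainEquiv hd hN ((gF : Uq R) • x) = opF i N (chainEquiv hd hN x) :=
  LinearMap.congr_fun (Uq.lift_F (chain_isTriple hd hN)) x

theorem chain_gK (x : chain i N hd hN) :
    chainEquiv hd hN ((gK : Uq R) • x) = opK i N (chainEquiv hd hN x) :=
  LinearMap.congr_fun (Uq.lift_K (chain_isTriple hd hN)) x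

/-- The basis vectors `e^m` of `chain`, with `e^m = 0` for `m ≥ N`. -/
noncomputable def chainVec (m : ℕ) : chain i N hd hN := (chainEquiv hd hN).symm (vec N m)

theorem chainEquiv_chainVec (m : ℕ) : chainEquiv hd hN (chainVec hd hN m) = vec N m := rfl

theorem chainVec_of_le {m : ℕ} (h : N ≤ m) : chainVec hd hN m = 0 := by
  rw [chainVec, vec_of_le h, map_zero]

theorem gE_chainVec (m : ℕ) : (gE : Uq R) • chainVec hd hN m = chainVec hd hN (m + 1) :=
  (chainEquiv hd hN).injective (by rw [chain_gE, chainEquiv_chainVec, opE_vec, chainEquiv_chainVec])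

theorem gF_chainVec (m : ℕ) :
    (gF : Uq R) • chainVec hd hN m = lam i m • chainVec hd hN (m - 1) :=
  (chainEquiv hd hN).injective (by
    rw [chain_gF, chainEquiv_chainVec, opF_vec hN, map_smul, chainEquiv_chainVec])

theorem wt_chainVec (m : ℕ) : Wt R (i + (m : ZMod R.d)) (chainVec hd hN m) :=
  (chainEquiv hd hN).injective (by
    rw [chain_gK, chainEquiv_chainVec, opK_vec, map_smul, chainEquiv_chainVec])

/-- `chain` is generated by a vector `x` of weight `i` subject to `F x = 0` and `E ^ N x = 0`. -/
theorem exists_chain_hom {X : Type} [AddCommGroup X] [Module ℂ X] [Module (Uq R) X]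
    [IsScalarTower ℂ (Uq R) X] {x : X} (hx : Wt R i x) (hF : (gF : Uq R) • x = 0)
    (hE : (gE : Uq R) ^ N • x = 0) :
    ∃ f : chain i N hd hN →ₗ[Uq R] X, ∀ m, f (chainVec hd hN m) = (gE : Uq R) ^ m • x := by
  let g : (Fin N → ℂ) →ₗ[ℂ] X := onVec N fun m => (gE : Uq R) ^ m • x
  have hg : ∀ m, g (vec N m) = (gE : Uq R) ^ m • x := by
    intro m
    rcases Nat.lt_or_ge m N with h | h
    · exact onVec_vec _ h
    · obtain ⟨t, rfl⟩ := Nat.exists_eq_add_of_le h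
      rw [vec_of_le h, map_zero, add_comm, pow_add, mul_smul, hE, smul_zero]
  refine ⟨homOfGen (g ∘ₗ (chainEquiv hd hN).toLinearMap) (fun y => ?_) (fun y => ?_) (fun y => ?_),
    fun m => hg m⟩
  · have h : g ∘ₗ opE N = Algebra.lsmul ℂ ℂ X (gE : Uq R) ∘ₗ g := ext_vec fun m _ => by
      rw [LinearMap.comp_apply, opE_vec, hg, LinearMap.comp_apply, hg, lsmul_apply,
        pow_succ', mul_smul]
    have := LinearMap.congr_fun h (chainEquiv hd hN y)
    rwa [LinearMap.comp_apply, ← chain_gE] at this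
  · have h : g ∘ₗ opF i N = Algebra.lsmul ℂ ℂ X (gF : Uq R) ∘ₗ g := ext_vec fun m _ => by
      rw [LinearMap.comp_apply, opF_vec hN, map_smul, hg, LinearMap.comp_apply, hg,
        lsmul_apply, hx.F_E_pow, hF, smul_zero, zero_add]
    have := LinearMap.congr_fun h (chainEquiv hd hN y)
    rwa [LinearMap.comp_apply, ← chain_gF] at this
  · have h : g ∘ₗ opK i N = Algebra.lsmul ℂ ℂ X (gK : Uq R) ∘ₗ g := ext_vec fun m _ => by
      rw [LinearMap.comp_apply, opK_vec, map_smul, hg, LinearMap.comp_apply, hg,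
        lsmul_apply]
      exact (hx.raise_pow m).symm
    have := LinearMap.congr_fun h (chainEquiv hd hN y)
    rwa [LinearMap.comp_apply, ← chain_gK] at this

variable {hd hN} in
/-- If the scalars `lam` do not vanish, only the multiples of `e^0` are killed by `F`. -/
theorem chain_eq_of_gF_eq_zero (hl : ∀ t, 0 < t → t < N → lam i t ≠ 0) {y : chain i N hd hN}
    (hy : (gF : Uq R) • y = 0) : ∃ c : ℂ, y = c • chainVec hd hN 0 := by
  set p := chainEquiv hd hN y with hp
  have h0 : ∀ t, t + 1 < N → coord N (t + 1) p = 0 := by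
    intro t ht
    have h1 := coord_opF hN t p
    rw [hp, ← chain_gF, hy, map_zero, map_zero] at h1
    exact (mul_eq_zero.mp h1.symm).resolve_left (hl _ (by omega) ht)
  refine ⟨coord N 0 p, (chainEquiv hd hN).injective ?_⟩
  rw [map_smul, chainEquiv_chainVec, ← hp]
  conv_lhs => rw [sum_coord p]
  rcases N with _ | N
  · simp [vec_of_le]
  · rw [Finset.sum_range_succ', Finset.sum_eq_zero, zero_add]
    intro t ht
    rw [h0 t (by have := Finset.mem_range.mp ht; omega), zero_smul]

variable {hd hN} in
theorem chainVec_zero_mem (hl : ∀ t, 0 < t → t < N → lam i t ≠ 0)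
    {S : Submodule (Uq R) (chain i N hd hN)} (hS : S ≠ ⊥) : chainVec hd hN 0 ∈ S := by
  obtain ⟨y, hyS, hy, hFy, -⟩ := exists_lowest_weight hS
  obtain ⟨c, rfl⟩ := chain_eq_of_gF_eq_zero hl hFy
  have hc : c ≠ 0 := by
    rintro rfl
    exact hy (zero_smul _ _)
  have := S.smul_of_tower_mem c⁻¹ hyS
  rwa [inv_smul_smul₀ hc] at this

variable {hd hN} in
theorem chain_hom_injective (hl : ∀ t, 0 < t → t < N → lam i t ≠ 0) {X : Type*} [AddCommGroup X]
    [Module (Uq R) X] (f : chain i N hd hN →ₗ[Uq R] X) (hf : f (chainVec hd hN 0) ≠ 0) :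
    Function.Injective f := by
  rw [← LinearMap.ker_eq_bot]
  by_contra hk
  exact hf (chainVec_zero_mem hl hk)

end Chain

section Simple

theorem lam_ne_zero_of_two_mul_eq_one {k : ZMod R.d} (hk : 2 * k = 1) {t : ℕ} (h0 : 0 < t)
    (ht : t < R.d) : lam k t ≠ 0 := by
  rw [Ne, lam_eq_zero_iff h0 ht, hk, sub_self]
  intro h
  have := natCast_inj_of_lt ht (Nat.pos_of_ne_zero (NeZero.ne R.d)) (h.trans Nat.cast_zero.symm)
  omega

/-- For `2 k = 1` the scalar `lam k t` vanishes only for `t = 0`, so `E F` acts on the weight space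
of weight `k` without nilpotent part. -/
theorem chain_isUniversal {k : ZMod R.d} (hk : 2 * k = 1) :
    IsUniversal (chain k R.d le_rfl (lam_d k)) k 1 (chainVec le_rfl (lam_d k) 0) := by
  have hk1 : 1 - k = k := by linear_combination -hk
  have hd : 0 < R.d := Nat.pos_of_ne_zero (NeZero.ne R.d)
  have hl : ∀ t, 0 < t → t < R.d → lam k t ≠ 0 := fun t h0 ht =>
    lam_ne_zero_of_two_mul_eq_one hk h0 ht
  have hw : Wt R k (chainVec le_rfl (lam_d k) 0) := by
    simpa using wt_chainVec le_rfl (lam_d k) 0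
  have hF : (gF : Uq R) • chainVec le_rfl (lam_d k) 0 = 0 := by
    rw [gF_chainVec, lam_zero, zero_smul]
  refine ⟨?_, ⟨hw, ?_⟩, ?_, fun S hS => ?_, ?_⟩
  · rw [Finset.card_eq_one]
    refine ⟨0, Finset.ext fun s => ?_⟩
    rw [Finset.mem_filter, Finset.mem_range, Finset.mem_singleton, hk1]
    constructor
    · rintro ⟨h1, h2⟩
      by_contra h3
      exact hl s (by omega) h1 h2
    · rintro rfl
      exact ⟨hd, lam_zero k⟩
  · rw [pow_one, mul_smul, hF, smul_zero]
  · intro X _ _ _ _ x hx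
    have hFx : (gF : Uq R) • x = 0 := by
      have := hx.1.lower_descend (r := 1) (t := R.d) (by rw [← mul_smul, ← pow_one (_ * _), hx.2])
        hd (gF_pow_d x) fun s h1 h2 => by rw [hk1]; exact hl s h1 h2
      rwa [pow_one] at this
    obtain ⟨f, hf⟩ := exists_chain_hom le_rfl (lam_d k) hx.1 hFx (gE_pow_d x)
    exact ⟨f, by rw [hf, pow_zero, one_smul]⟩
  · rw [Nat.sub_self, pow_zero, one_smul]
    exact chainVec_zero_mem hl hS
  · refine ⟨(dualEquiv R _).symm (coord R.d 0 ∘ₗ (chainEquiv le_rfl (lam_d k)).toLinearMap),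
      ⟨dual_ext fun x => ?_, dual_ext fun x => ?_⟩, ?_⟩
    · rw [dual_gK, LinearEquiv.apply_symm_apply, (dualEquiv R _).map_smul, LinearEquiv.apply_symm_apply,
        LinearMap.comp_apply, LinearEquiv.coe_coe, chain_gK, LinearMap.smul_apply,
        LinearMap.comp_apply, LinearEquiv.coe_coe]
      have h : coord R.d 0 ∘ₗ opK k R.d = kw k • coord R.d 0 := ext_vec fun m _ => by
        rw [LinearMap.comp_apply, opK_vec, map_smul, LinearMap.smul_apply, coord_vec]
        by_cases h : m = 0
        · simp [h]
        · simp [h]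
      exact LinearMap.congr_fun h _
    · rw [dual_EF_pow, LinearEquiv.apply_symm_apply, pow_one, mul_smul, LinearMap.comp_apply,
        LinearEquiv.coe_coe, chain_gE, map_zero, LinearMap.zero_apply]
      have h : coord R.d 0 ∘ₗ opE R.d = 0 := ext_vec fun m _ => by
        rw [LinearMap.comp_apply, opE_vec, coord_vec, if_neg (by omega), LinearMap.zero_apply]
      exact LinearMap.congr_fun h _
    · rw [Nat.sub_self, pow_zero, one_smul, LinearEquiv.apply_symm_apply, LinearMap.comp_apply,
        LinearEquiv.coe_coe, chainEquiv_chainVec, coord_vec]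
      simp [hd]

end Simple

/-! ### The modules `bigMod` -/

section Big

variable {k : ZMod R.d} (hk : 2 * k ≠ 1)

/-- The vector space underlying `bigMod`. -/
noncomputable def bigEquiv : bigMod k hk ≃ₗ[ℂ] (Fin R.d → ℂ) × (Fin R.d → ℂ) :=
  LinearEquiv.refl ℂ ((Fin R.d → ℂ) × (Fin R.d → ℂ))

instance bigMod_finiteDimensional : FiniteDimensional ℂ (bigMod k hk) :=
  (bigEquiv hk).symm.finiteDimensional

theorem finrank_bigMod : Module.finrank ℂ (bigMod k hk) = 2 * R.d := by
  rw [(bigEquiv hk).finrank_eq, Module.finrank_prod, Module.finrank_fin_fun, two_mul]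

theorem big_gE (x : bigMod k hk) : bigEquiv hk ((gE : Uq R) • x) = bigE (bigEquiv hk x) :=
  LinearMap.congr_fun (Uq.lift_E (big_isTriple hk)) x

theorem big_gF (x : bigMod k hk) : bigEquiv hk ((gF : Uq R) • x) = bigF k (bigEquiv hk x) :=
  LinearMap.congr_fun (Uq.lift_F (big_isTriple hk)) x

theorem big_gK (x : bigMod k hk) : bigEquiv hk ((gK : Uq R) • x) = bigK k (bigEquiv hk x) :=
  LinearMap.congr_fun (Uq.lift_K (big_isTriple hk)) x

/-- The basis vectors `e_k^m` of `bigMod k`. -/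
noncomputable def lowVec (m : ℕ) : bigMod k hk := (bigEquiv hk).symm (vec R.d m, 0)

/-- The basis vectors `e_{1-k}^m` of `bigMod k`. -/
noncomputable def topVec (m : ℕ) : bigMod k hk := (bigEquiv hk).symm (0, vec R.d m)

theorem gE_lowVec (m : ℕ) : (gE : Uq R) • lowVec hk m = lowVec hk (m + 1) :=
  (bigEquiv hk).injective ((big_gE hk _).trans (bigE_left m))

theorem gE_topVec (m : ℕ) : (gE : Uq R) • topVec hk m = topVec hk (m + 1) :=
  (bigEquiv hk).injective ((big_gE hk _).trans (bigE_right m))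

theorem gE_pow_lowVec (m t : ℕ) : (gE : Uq R) ^ t • lowVec hk m = lowVec hk (m + t) := by
  induction t with
  | zero => simp
  | succ t ih => rw [pow_succ', mul_smul, ih, gE_lowVec, add_assoc]

theorem gF_lowVec (m : ℕ) : (gF : Uq R) • lowVec hk m = lam k m • lowVec hk (m - 1) :=
  (bigEquiv hk).injective ((big_gF hk _).trans ((bigF_left k m).trans (by
    rw [map_smul]; simp [lowVec])))

theorem wt_lowVec (m : ℕ) : Wt R (k + (m : ZMod R.d)) (lowVec hk m) :=
  (bigEquiv hk).injective ((big_gK hk _).trans (bigK_left k m))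

theorem wt_topVec (m : ℕ) : Wt R (1 - k + (m : ZMod R.d)) (topVec hk m) :=
  (bigEquiv hk).injective ((big_gK hk _).trans (bigK_right k m))

/-- `bigMod k` is generated by vectors `x` and `y` of weights `1 - k` and `k` subject to `F y = 0` and
`F x = E ^ a y`, where `a` is the residue of `-2 k`. -/
theorem exists_big_hom {X : Type} [AddCommGroup X] [Module ℂ X] [Module (Uq R) X]
    [IsScalarTower ℂ (Uq R) X] {x y : X} (hx : Wt R (1 - k) x) (hy : Wt R k y)
    (hFy : (gF : Uq R) • y = 0) (hFx : (gF : Uq R) • x = (gE : Uq R) ^ (-2 * k).val • y) :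
    ∃ f : bigMod k hk →ₗ[Uq R] X, f (topVec hk 0) = x := by
  let g : (Fin R.d → ℂ) × (Fin R.d → ℂ) →ₗ[ℂ] X :=
    LinearMap.coprod (onVec R.d fun m => (gE : Uq R) ^ m • y) (onVec R.d fun m => (gE : Uq R) ^ m • x)
  have hv : ∀ (z : X) (m : ℕ), onVec R.d (fun m => (gE : Uq R) ^ m • z) (vec R.d m)
      = (gE : Uq R) ^ m • z := by
    intro z m
    rcases Nat.lt_or_ge m R.d with h | h
    · exact onVec_vec _ h
    · obtain ⟨t, rfl⟩ := Nat.exists_eq_add_of_le h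
      rw [vec_of_le h, map_zero, add_comm, pow_add, mul_smul, gE_pow_d, smul_zero]
  have hg1 : ∀ m, g (vec R.d m, 0) = (gE : Uq R) ^ m • y := fun m => by
    simp only [g, LinearMap.coprod_apply, map_zero, add_zero, hv]
  have hg2 : ∀ m, g (0, vec R.d m) = (gE : Uq R) ^ m • x := fun m => by
    simp only [g, LinearMap.coprod_apply, map_zero, zero_add, hv]
  have hg3 : ∀ (m n : ℕ) (c : ℂ), g (vec R.d m, c • vec R.d n)
      = (gE : Uq R) ^ m • y + c • (gE : Uq R) ^ n • x := fun m n c => by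
    simp only [g, LinearMap.coprod_apply, map_smul, hv]
  have ext : ∀ {f f' : (Fin R.d → ℂ) × (Fin R.d → ℂ) →ₗ[ℂ] X},
      (∀ m, f (vec R.d m, 0) = f' (vec R.d m, 0)) →
      (∀ m, f (0, vec R.d m) = f' (0, vec R.d m)) → f = f' := fun h1 h2 =>
    LinearMap.prod_ext (ext_vec fun m _ => by simpa using h1 m)
      (ext_vec fun m _ => by simpa using h2 m)
  refine ⟨homOfGen (g ∘ₗ (bigEquiv hk).toLinearMap) (fun w => ?_) (fun w => ?_) (fun w => ?_), ?_⟩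
  · have h : g ∘ₗ bigE = Algebra.lsmul ℂ ℂ X (gE : Uq R) ∘ₗ g := by
      refine ext (fun m => ?_) fun m => ?_
      · rw [LinearMap.comp_apply, bigE_left, hg1, LinearMap.comp_apply, hg1, lsmul_apply,
          pow_succ', mul_smul]
      · rw [LinearMap.comp_apply, bigE_right, hg2, LinearMap.comp_apply, hg2, lsmul_apply,
          pow_succ', mul_smul]
    have := LinearMap.congr_fun h (bigEquiv hk w)
    rwa [LinearMap.comp_apply, ← big_gE] at this
  · have h : g ∘ₗ bigF k = Algebra.lsmul ℂ ℂ X (gF : Uq R) ∘ₗ g := by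
      refine ext (fun m => ?_) fun m => ?_
      · have : ((lam k m • vec R.d (m - 1), 0) : (Fin R.d → ℂ) × (Fin R.d → ℂ))
            = lam k m • (vec R.d (m - 1), 0) := by simp
        rw [LinearMap.comp_apply, bigF_left, this, map_smul, hg1, LinearMap.comp_apply, hg1,
          lsmul_apply, hy.F_E_pow, hFy, smul_zero, zero_add]
      · rw [LinearMap.comp_apply, bigF_right, hg3, LinearMap.comp_apply, hg2,
          lsmul_apply, hx.F_E_pow, hFx, ← mul_smul, ← pow_add, add_comm m]
    have := LinearMap.congr_fun h (bigEquiv hk w)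
    rwa [LinearMap.comp_apply, ← big_gF] at this
  · have h : g ∘ₗ bigK k = Algebra.lsmul ℂ ℂ X (gK : Uq R) ∘ₗ g := by
      refine ext (fun m => ?_) fun m => ?_
      · rw [LinearMap.comp_apply, bigK_left, map_smul, hg1, LinearMap.comp_apply, hg1,
          lsmul_apply]
        exact (hy.raise_pow m).symm
      · rw [LinearMap.comp_apply, bigK_right, map_smul, hg2, LinearMap.comp_apply, hg2,
          lsmul_apply]
        exact (hx.raise_pow m).symm
    have := LinearMap.congr_fun h (bigEquiv hk w)
    rwa [LinearMap.comp_apply, ← big_gK] at this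
  · exact (hg2 0).trans (by rw [pow_zero, one_smul])

theorem val_add_one_lt {k : ZMod R.d} (hk : 2 * k ≠ 1) : (-2 * k).val + 1 < R.d := by
  have h1 := ZMod.val_lt (-2 * k)
  refine lt_of_le_of_ne h1 fun h => hk ?_
  have h2 : (((-2 * k).val + 1 : ℕ) : ZMod R.d) = 0 := by rw [h, ZMod.natCast_self]
  rw [Nat.cast_succ, ZMod.natCast_zmod_val] at h2
  linear_combination -h2

theorem gF_topVec (m : ℕ) : (gF : Uq R) • topVec hk m
    = lowVec hk ((-2 * k).val + m) + lam (1 - k) m • topVec hk (m - 1) :=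
  (bigEquiv hk).injective ((big_gF hk _).trans ((bigF_right k m).trans (by
    rw [map_add, map_smul]; simp [lowVec, topVec])))

theorem bigMod_ext {W : Type} [AddCommGroup W] [Module ℂ W] {f g : bigMod k hk →ₗ[ℂ] W}
    (h1 : ∀ m < R.d, f (lowVec hk m) = g (lowVec hk m))
    (h2 : ∀ m < R.d, f (topVec hk m) = g (topVec hk m)) : f = g := by
  have h : f ∘ₗ (bigEquiv hk).symm.toLinearMap = g ∘ₗ (bigEquiv hk).symm.toLinearMap :=
    LinearMap.prod_ext (ext_vec fun m hm => h1 m hm) (ext_vec fun m hm => h2 m hm)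
  ext x
  simpa using LinearMap.congr_fun h (bigEquiv hk x)

theorem EF_lowVec (m : ℕ) :
    ((gE : Uq R) * gF) • lowVec hk m = lam k m • lowVec hk m := by
  rw [mul_smul, gF_lowVec, smul_comm, gE_lowVec]
  cases m with
  | zero => simp [lam_zero]
  | succ m => rfl

theorem EF_topVec (m : ℕ) : ((gE : Uq R) * gF) • topVec hk m
    = lowVec hk ((-2 * k).val + m + 1) + lam (1 - k) m • topVec hk m := by
  rw [mul_smul, gF_topVec, smul_add, smul_comm, gE_lowVec, gE_topVec]
  cases m with
  | zero => simp [lam_zero]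
  | succ m => rfl

/-- The functional that reads off the coefficient of `e_k^t`. -/
noncomputable def lowCoord (t : ℕ) : bigMod k hk →ₗ[ℂ] ℂ :=
  coord R.d t ∘ₗ LinearMap.fst ℂ _ _ ∘ₗ (bigEquiv hk).toLinearMap

/-- The functional that reads off the coefficient of `e_{1-k}^t`. -/
noncomputable def topCoord (t : ℕ) : bigMod k hk →ₗ[ℂ] ℂ :=
  coord R.d t ∘ₗ LinearMap.snd ℂ _ _ ∘ₗ (bigEquiv hk).toLinearMap

theorem lowCoord_lowVec (t m : ℕ) :
    lowCoord hk t (lowVec hk m) = if m = t ∧ m < R.d then 1 else 0 := coord_vec _ _ _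

theorem lowCoord_topVec (t m : ℕ) : lowCoord hk t (topVec hk m) = 0 := map_zero (coord R.d t)

theorem topCoord_topVec (t m : ℕ) :
    topCoord hk t (topVec hk m) = if m = t ∧ m < R.d then 1 else 0 := coord_vec _ _ _

theorem topCoord_lowVec (t m : ℕ) : topCoord hk t (lowVec hk m) = 0 := map_zero (coord R.d t)

theorem sum_lowCoord_add_sum_topCoord (y : bigMod k hk) :
    y = ∑ t ∈ Finset.range R.d, lowCoord hk t y • lowVec hk t
      + ∑ t ∈ Finset.range R.d, topCoord hk t y • topVec hk t := by
  refine (bigEquiv hk).injective ?_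
  rw [map_add, map_sum, map_sum]
  simp only [map_smul]
  refine Prod.ext ?_ ?_
  · simp only [Prod.fst_add, Prod.fst_sum, Prod.smul_fst, topVec, lowVec, LinearEquiv.apply_symm_apply,
      smul_zero, Finset.sum_const_zero, add_zero]
    exact sum_coord (bigEquiv hk y).1
  · simp only [Prod.snd_add, Prod.snd_sum, Prod.smul_snd, topVec, lowVec, LinearEquiv.apply_symm_apply,
      smul_zero, Finset.sum_const_zero, zero_add]
    exact sum_coord (bigEquiv hk y).2

theorem lowCoord_gF {t : ℕ} (ht : t < R.d) (y : bigMod k hk) :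
    lowCoord hk t ((gF : Uq R) • y) = lam k (t + 1) * lowCoord hk (t + 1) y
      + if (-2 * k).val ≤ t then topCoord hk (t - (-2 * k).val) y else 0 := by
  have h : lowCoord hk t ∘ₗ Algebra.lsmul ℂ ℂ (bigMod k hk) (gF : Uq R)
      = lam k (t + 1) • lowCoord hk (t + 1)
        + if (-2 * k).val ≤ t then topCoord hk (t - (-2 * k).val) else 0 := by
    refine bigMod_ext hk (fun m hm => ?_) fun m hm => ?_
    · rw [LinearMap.comp_apply, lsmul_apply, gF_lowVec, map_smul, LinearMap.add_apply,
        LinearMap.smul_apply, lowCoord_lowVec, lowCoord_lowVec]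
      have : (if (-2 * k).val ≤ t then topCoord hk (t - (-2 * k).val) else 0) (lowVec hk m) = 0 := by
        split_ifs
        · exact topCoord_lowVec hk _ _
        · rfl
      rw [this, add_zero]
      cases m with
      | zero => simp [lam_zero]
      | succ m =>
        by_cases h : m = t
        · subst h
          simp [hm, ht]
        · simp [h]
    · rw [LinearMap.comp_apply, lsmul_apply, gF_topVec, map_add, map_smul, lowCoord_topVec,
        smul_zero, add_zero, LinearMap.add_apply, LinearMap.smul_apply, lowCoord_topVec, smul_zero,
        zero_add, lowCoord_lowVec]
      split_ifs with h1 h2 h2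
      · rw [topCoord_topVec, if_pos (by omega)]
      · omega
      · rw [topCoord_topVec, if_neg (by omega)]
      · rfl
  have := LinearMap.congr_fun h y
  rw [LinearMap.comp_apply, lsmul_apply, LinearMap.add_apply, LinearMap.smul_apply] at this
  rw [this]
  split_ifs <;> rfl

theorem topCoord_gF (t : ℕ) (y : bigMod k hk) :
    topCoord hk t ((gF : Uq R) • y) = lam (1 - k) (t + 1) * topCoord hk (t + 1) y := by
  have h : topCoord hk t ∘ₗ Algebra.lsmul ℂ ℂ (bigMod k hk) (gF : Uq R)
      = lam (1 - k) (t + 1) • topCoord hk (t + 1) := by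
    refine bigMod_ext hk (fun m hm => ?_) fun m hm => ?_
    · rw [LinearMap.comp_apply, lsmul_apply, gF_lowVec, map_smul, LinearMap.smul_apply,
        topCoord_lowVec, topCoord_lowVec, smul_zero, smul_zero]
    · rw [LinearMap.comp_apply, lsmul_apply, gF_topVec, map_add, map_smul, LinearMap.smul_apply,
        topCoord_lowVec, zero_add, topCoord_topVec, topCoord_topVec]
      cases m with
      | zero => simp [lam_zero]
      | succ m =>
        by_cases h : m = t
        · subst h
          simp [hm, Nat.lt_of_succ_lt hm]
        · simp [h]
  exact LinearMap.congr_fun h y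

theorem lam_val_add_one (k : ZMod R.d) : lam k ((-2 * k).val + 1) = 0 :=
  lam_eq_zero (ZMod.natCast_zmod_val _)

theorem lam_ne_zero_of_ne_val_add_one {k : ZMod R.d} (hk : 2 * k ≠ 1) {t : ℕ} (h0 : 0 < t)
    (ht : t < R.d) (hta : t ≠ (-2 * k).val + 1) : lam k t ≠ 0 := by
  rw [Ne, lam_eq_zero_iff h0 ht]
  intro h
  refine hta (natCast_inj_of_lt ht (val_add_one_lt hk) ?_)
  rw [h, Nat.cast_succ, ZMod.natCast_zmod_val]
  ring

/-- The vectors of `bigMod k` killed by `F` are the combinations of `e_k^0` and `e_k^(a+1)`. -/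
theorem big_eq_of_gF_eq_zero {y : bigMod k hk} (hy : (gF : Uq R) • y = 0) :
    ∃ c c' : ℂ, y = c • lowVec hk 0 + c' • lowVec hk ((-2 * k).val + 1) := by
  have ha := val_add_one_lt hk
  have htop : ∀ t < R.d, topCoord hk t y = 0 := by
    intro t ht
    rcases Nat.eq_zero_or_pos t with rfl | h0
    · have h1 := lowCoord_gF hk (t := (-2 * k).val) (by omega) y
      rw [hy, map_zero, lam_val_add_one, zero_mul, zero_add, if_pos le_rfl, Nat.sub_self] at h1
      exact h1.symm
    by_cases hta : t + (-2 * k).val + 1 = R.d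
    · have h1 := lowCoord_gF hk (t := R.d - 1) (by omega) y
      rw [hy, map_zero, Nat.sub_add_cancel (by omega), lam_d, zero_mul, zero_add,
        if_pos (by omega), show R.d - 1 - (-2 * k).val = t by omega] at h1
      exact h1.symm
    · obtain ⟨s, rfl⟩ : ∃ s, t = s + 1 := ⟨t - 1, by omega⟩
      have h1 := topCoord_gF hk s y
      rw [hy, map_zero] at h1
      refine (mul_eq_zero.mp h1.symm).resolve_left ?_
      rw [lam_eq_zero_iff (by omega) ht]
      intro h2
      refine hta (?_ : _ = _)
      have h3 : ((s + 1 : ℕ) : ZMod R.d) = ((R.d - 1 - (-2 * k).val : ℕ) : ZMod R.d) := by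
        rw [h2, Nat.sub_sub, Nat.cast_sub (by omega), ZMod.natCast_self, Nat.cast_add,
          ZMod.natCast_zmod_val]
        push_cast
        ring
      have := natCast_inj_of_lt ht (by omega) h3
      omega
  have hlow : ∀ t < R.d, t ≠ 0 → t ≠ (-2 * k).val + 1 → lowCoord hk t y = 0 := by
    intro t ht h0 hta
    obtain ⟨s, rfl⟩ : ∃ s, t = s + 1 := ⟨t - 1, by omega⟩
    have h1 := lowCoord_gF hk (t := s) (by omega) y
    rw [hy, map_zero, htop _ (by omega), ite_self, add_zero] at h1
    exact (mul_eq_zero.mp h1.symm).resolve_left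
      (lam_ne_zero_of_ne_val_add_one hk (by omega) ht hta)
  refine ⟨lowCoord hk 0 y, lowCoord hk ((-2 * k).val + 1) y, ?_⟩
  conv_lhs => rw [sum_lowCoord_add_sum_topCoord hk y]
  rw [Finset.sum_eq_zero (s := Finset.range R.d) (f := fun t => topCoord hk t y • topVec hk t)
    (fun t ht => by rw [htop t (Finset.mem_range.mp ht), zero_smul]), add_zero,
    ← Finset.sum_pair (f := fun t => lowCoord hk t y • lowVec hk t) (Nat.succ_ne_zero _).symm]
  refine (Finset.sum_subset (fun t ht => ?_) fun t ht hta => ?_).symm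
  · rw [Finset.mem_insert, Finset.mem_singleton] at ht
    exact Finset.mem_range.mpr (by omega)
  · rw [Finset.mem_insert, Finset.mem_singleton, not_or] at hta
    rw [hlow t (Finset.mem_range.mp ht) hta.1 hta.2, zero_smul]

theorem add_val_add_one (k : ZMod R.d) : k + (((-2 * k).val + 1 : ℕ) : ZMod R.d) = 1 - k := by
  rw [Nat.cast_succ, ZMod.natCast_zmod_val]
  ring

theorem lowVec_mem {S : Submodule (Uq R) (bigMod k hk)} (hS : S ≠ ⊥) :
    lowVec hk ((-2 * k).val + 1) ∈ S := by
  obtain ⟨y, hyS, hy, hFy, -⟩ := exists_lowest_weight hS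
  obtain ⟨c, c', rfl⟩ := big_eq_of_gF_eq_zero hk hFy
  by_cases hc : c' = 0
  · rw [hc, zero_smul, add_zero] at hy hyS
    have hc0 : c ≠ 0 := by
      rintro rfl
      exact hy (zero_smul _ _)
    have h1 := S.smul_mem ((gE : Uq R) ^ ((-2 * k).val + 1)) (S.smul_of_tower_mem c⁻¹ hyS)
    rwa [inv_smul_smul₀ hc0, gE_pow_lowVec, zero_add] at h1
  · have h0 := wt_lowVec hk 0
    have h1 := wt_lowVec hk ((-2 * k).val + 1)
    rw [add_val_add_one] at h1
    rw [Nat.cast_zero, add_zero] at h0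
    have hne : (kw (1 - k) - kw k) * c' ≠ 0 := by
      refine mul_ne_zero (sub_ne_zero.mpr fun h => hk ?_) hc
      linear_combination -kw_injective h
    have h2 := S.sub_mem (S.smul_mem (gK : Uq R) hyS) (S.smul_of_tower_mem (kw k) hyS)
    rw [smul_add, smul_comm, smul_comm _ c', h0, h1, smul_add, add_sub_add_comm, smul_comm c,
      sub_self, zero_add, smul_comm c', ← sub_smul, smul_smul] at h2
    have h3 := S.smul_of_tower_mem (((kw (1 - k) - kw k) * c')⁻¹) h2
    rwa [inv_smul_smul₀ hne] at h3

/-- The possible weights of the vectors killed by `F`. -/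
theorem big_weight {y : bigMod k hk} (hy : (gF : Uq R) • y = 0) (h0 : y ≠ 0) {m : ZMod R.d}
    (hm : Wt R m y) : m = k ∨ m = 1 - k := by
  obtain ⟨c, c', rfl⟩ := big_eq_of_gF_eq_zero hk hy
  by_contra! hne
  have ha := val_add_one_lt hk
  have h0' := wt_lowVec hk 0
  have h1 := wt_lowVec hk ((-2 * k).val + 1)
  rw [add_val_add_one] at h1
  rw [Nat.cast_zero, add_zero] at h0'
  unfold Wt at hm h0' h1
  rw [smul_add, smul_comm, smul_comm _ c', h0', h1] at hm
  have e0 := congrArg (lowCoord hk 0) hm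
  have e1 := congrArg (lowCoord hk ((-2 * k).val + 1)) hm
  simp only [map_add, map_smul, lowCoord_lowVec, smul_eq_mul] at e0 e1
  simp [ha, Nat.pos_of_ne_zero (NeZero.ne R.d), -neg_mul] at e0 e1
  have hc : c = 0 := by
    have h : c * (kw k - kw m) = 0 := by linear_combination e0
    exact (mul_eq_zero.mp h).resolve_right (sub_ne_zero.mpr fun h => hne.1 (kw_injective h).symm)
  have hc' : c' = 0 := by
    have h : c' * (kw (1 - k) - kw m) = 0 := by linear_combination e1
    exact (mul_eq_zero.mp h).resolve_right (sub_ne_zero.mpr fun h => hne.2 (kw_injective h).symm)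
  exact h0 (by rw [hc, hc', zero_smul, zero_smul, add_zero])

/-- The vector `F E F x` vanishes because `F ^ d = 0` and the scalars `lam k t` vanish, for
`0 < t < d`, only at `t = a + 1`; this leaves the relations of `exists_big_hom`, with `y` the suitable
multiple of `F ^ (a + 1) x`. -/
theorem exists_hom_of_isGen {X : Type} [AddCommGroup X] [Module ℂ X] [Module (Uq R) X]
    [IsScalarTower ℂ (Uq R) X] {x : X} (hx : IsGen (1 - k) 2 x) :
    ∃ f : bigMod k hk →ₗ[Uq R] X, f (topVec hk 0) = x := by
  obtain ⟨hw, hx2⟩ := hx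
  set a := (-2 * k).val with ha
  have had : a + 1 < R.d := val_add_one_lt hk
  have hl : ∀ t, 0 < t → t < R.d → t ≠ a + 1 → lam (1 - (1 - k)) t ≠ 0 := by
    intro t h0 ht hta
    rw [sub_sub_cancel]
    exact lam_ne_zero_of_ne_val_add_one hk h0 ht hta
  have hla : lam (1 - (1 - k)) (a + 1) = 0 := by rw [sub_sub_cancel, ha, lam_val_add_one]
  set v : X := (gE : Uq R) • (gF : Uq R) • x with hv
  have hvw : Wt R (1 - k) v := by
    have := hw.lower.raise
    rwa [sub_add_cancel] at this
  have hv0 : (gE : Uq R) • (gF : Uq R) • v = 0 := by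
    rw [hv, ← mul_smul gE gF x, ← mul_smul gE gF, ← mul_smul, ← sq, hx2]
  -- `E F v = 0` lets `F ^ d v = 0` descend as far as the zero of `lam k` at `a + 1`
  have hv1 : ∀ t, a + 2 ≤ t → (gF : Uq R) ^ t • v = 0 := by
    intro t ht
    have h1 : (gF : Uq R) ^ (a + 2) • v = 0 :=
      hvw.lower_descend hv0 (by omega) (gF_pow_d v) fun s h1 h2 => hl s (by omega) h2 (by omega)
    obtain ⟨s, rfl⟩ := Nat.exists_eq_add_of_le ht
    rw [add_comm, pow_add, mul_smul, h1, smul_zero]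
  have hx1 : (gF : Uq R) ^ (a + 2) • x = 0 := by
    have key : ∀ t, a + 2 ≤ t → t ≤ R.d → (gF : Uq R) ^ t • x = 0 → (gF : Uq R) ^ (a + 2) • x = 0 := by
      intro t ht
      induction t, ht using Nat.le_induction with
      | base => exact fun _ h => h
      | succ t ht ih =>
        intro htd h
        refine ih (by omega) ?_
        have h1 := hw.E_F_pow_succ t
        rw [h, smul_zero, smul_add, ← hv, hv1 t ht, zero_add, smul_comm] at h1
        exact (smul_eq_zero.mp h1.symm).resolve_left (hl t (by omega) (by omega) (by omega))
    exact key R.d (by omega) le_rfl (gF_pow_d x)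
  -- at `t = a + 1` the scalar vanishes, which transfers the relation from `x` to `v`
  have hv2 : (gF : Uq R) ^ (a + 1) • v = 0 := by
    have h1 := hw.E_F_pow_succ (a + 1)
    rw [hx1, smul_zero, hla, zero_smul, add_zero] at h1
    exact h1.symm
  have hFv : (gF : Uq R) • v = 0 := by
    have := hvw.lower_descend (r := 1) hv0 (by omega) hv2 fun s h1 h2 =>
      hl s h1 (by omega) (by omega)
    rwa [pow_one] at this
  obtain ⟨c, hc, hcx⟩ : ∃ c : ℂ, c ≠ 0 ∧
      (gE : Uq R) ^ a • (gF : Uq R) ^ (a + 1) • x = c • (gF : Uq R) • x := by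
    have key : ∀ t, t ≤ a → ∃ c : ℂ, c ≠ 0 ∧
        (gE : Uq R) ^ t • (gF : Uq R) ^ (t + 1) • x = c • (gF : Uq R) • x := by
      intro t
      induction t with
      | zero => exact fun _ => ⟨1, one_ne_zero, by simp⟩
      | succ t ih =>
        intro ht
        obtain ⟨c, hc, hcx⟩ := ih (by omega)
        refine ⟨lam (1 - (1 - k)) (t + 1) * c,
          mul_ne_zero (hl (t + 1) (by omega) (by omega) (by omega)) hc, ?_⟩
        rw [pow_succ (gE : Uq R), mul_smul, hw.E_F_pow_succ (t + 1), ← hv, smul_add,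
          pow_succ _ t, mul_smul _ _ v, hFv, smul_zero, zero_add, ← pow_succ, smul_comm _ (lam _ _),
          smul_comm _ (lam _ _), hcx, smul_smul]
    exact key a le_rfl
  refine exists_big_hom hk (y := c⁻¹ • (gF : Uq R) ^ (a + 1) • x) hw (Wt.smul ?_ _) ?_ ?_
  · have h1 := hw.lower_pow (a + 1)
    rwa [← add_val_add_one k, add_sub_cancel_right] at h1
  · rw [smul_comm, ← mul_smul, ← pow_succ', hx1, smul_zero]
  · rw [smul_comm, hcx, inv_smul_smul₀ hc]

theorem big_isUniversal : IsUniversal (bigMod k hk) (1 - k) 2 (topVec hk 0) := by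
  have ha := val_add_one_lt hk
  have hs : ((gE : Uq R) * gF) ^ (2 - 1) • topVec hk 0 = lowVec hk ((-2 * k).val + 1) := by
    rw [pow_one, EF_topVec, lam_zero, zero_smul, add_zero, add_zero]
  refine ⟨?_, ⟨by simpa using wt_topVec hk 0, ?_⟩, fun X _ _ _ _ x hx => exists_hom_of_isGen hk hx,
    fun S hS => ?_, ?_⟩
  · rw [sub_sub_cancel, Finset.card_eq_two]
    refine ⟨0, (-2 * k).val + 1, (Nat.succ_ne_zero _).symm, Finset.ext fun s => ?_⟩
    rw [Finset.mem_filter, Finset.mem_range, Finset.mem_insert, Finset.mem_singleton]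
    constructor
    · rintro ⟨h1, h2⟩
      by_contra! h3
      exact lam_ne_zero_of_ne_val_add_one hk (by omega) h1 h3.2 h2
    · rintro (rfl | rfl)
      · exact ⟨by omega, lam_zero k⟩
      · exact ⟨ha, lam_val_add_one k⟩
  · rw [pow_succ, mul_smul, EF_topVec, lam_zero, zero_smul, add_zero, add_zero, pow_one, EF_lowVec,
      lam_val_add_one, zero_smul]
  · rw [hs]
    exact lowVec_mem hk hS
  · refine ⟨(dualEquiv R _).symm (lowCoord hk ((-2 * k).val + 1)),
      ⟨dual_ext fun x => ?_, dual_ext fun x => ?_⟩, ?_⟩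
    · rw [dual_gK, (dualEquiv R _).map_smul, LinearEquiv.apply_symm_apply]
      have h : lowCoord hk ((-2 * k).val + 1) ∘ₗ Algebra.lsmul ℂ ℂ (bigMod k hk) (gK : Uq R)
          = kw (1 - k) • lowCoord hk ((-2 * k).val + 1) := by
        refine bigMod_ext hk (fun m _ => ?_) fun m _ => ?_
        · rw [LinearMap.comp_apply, lsmul_apply, wt_lowVec, map_smul, LinearMap.smul_apply,
            lowCoord_lowVec]
          by_cases h : m = (-2 * k).val + 1
          · rw [h, add_val_add_one]
          · simp [h, -neg_mul]
        · rw [LinearMap.comp_apply, lsmul_apply, wt_topVec, map_smul, LinearMap.smul_apply,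
            lowCoord_topVec, smul_zero, smul_zero]
      exact LinearMap.congr_fun h x
    · rw [dual_EF_pow, LinearEquiv.apply_symm_apply, map_zero, LinearMap.zero_apply]
      have h : lowCoord hk ((-2 * k).val + 1)
          ∘ₗ Algebra.lsmul ℂ ℂ (bigMod k hk) (((gE : Uq R) * gF) ^ 2) = 0 := by
        refine bigMod_ext hk (fun m _ => ?_) fun m _ => ?_
        · rw [LinearMap.comp_apply, lsmul_apply, pow_two, mul_smul (gE * gF), EF_lowVec, smul_comm,
            EF_lowVec, map_smul, map_smul, lowCoord_lowVec, LinearMap.zero_apply]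
          by_cases h : m = (-2 * k).val + 1
          · rw [h, lam_val_add_one, zero_smul]
          · simp [h, -neg_mul]
        · rw [LinearMap.comp_apply, lsmul_apply, pow_two, mul_smul (gE * gF), EF_topVec, smul_add,
            EF_lowVec, smul_comm, EF_topVec, map_add, map_smul, map_smul, map_add, map_smul,
            lowCoord_lowVec, lowCoord_topVec, LinearMap.zero_apply]
          cases m with
          | zero => simp [lam_val_add_one, lam_zero, -neg_mul]
          | succ m => rw [if_neg (by omega)]; simp
      exact LinearMap.congr_fun h x
    · rw [LinearEquiv.apply_symm_apply, hs, lowCoord_lowVec, if_pos ⟨rfl, ha⟩]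
      exact one_ne_zero

end Big

/-! ### Tensor products -/

section Tensor

variable (X Y : UqMod R)

/-- The vector space underlying a tensor product of `u_q`-modules. -/
noncomputable def tensorEquiv : X.tensor Y ≃ₗ[ℂ] X ⊗[ℂ] Y := LinearEquiv.refl ℂ (X ⊗[ℂ] Y)

variable {X Y}

/-- The pure tensors, as elements of the `u_q`-module `X ⊗ Y`. -/
noncomputable def tmul (x : X) (y : Y) : X.tensor Y := (tensorEquiv X Y).symm (x ⊗ₜ[ℂ] y)

theorem tensor_smul (a : Uq R) (x : X) (y : Y) : tensorEquiv X Y (a • tmul x y)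
    = Module.endTensorEndAlgHom (R := ℂ) (S := ℂ) (A := ℂ) (M := X) (N := Y)
      (Algebra.TensorProduct.map X.ρ Y.ρ (Uq.comul R a)) (x ⊗ₜ[ℂ] y) := rfl

theorem zero_tmul (y : Y) : tmul (0 : X) y = 0 := by
  rw [tmul, TensorProduct.zero_tmul, map_zero]

theorem tmul_zero (x : X) : tmul x (0 : Y) = 0 := by
  rw [tmul, TensorProduct.tmul_zero, map_zero]

theorem gE_tmul (x : X) (y : Y) : (gE : Uq R) • tmul x y
    = tmul x ((gE : Uq R) • y) + tmul ((gE : Uq R) • x) ((gK : Uq R) • y) := by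
  refine (tensorEquiv X Y).injective ?_
  have h : Uq.comul R gE = (1 : Uq R) ⊗ₜ[ℂ] gE + gE ⊗ₜ[ℂ] gK := Uq.lift_E _
  rw [tensor_smul, h]
  simp [tmul, UqMod.smul_def, Module.endTensorEndAlgHom_apply]

theorem gF_tmul (x : X) (y : Y) : (gF : Uq R) • tmul x y
    = tmul ((gK : Uq R) ^ (R.d - 1) • x) ((gF : Uq R) • y) + tmul ((gF : Uq R) • x) y := by
  refine (tensorEquiv X Y).injective ?_
  have h : Uq.comul R gF = (gK ^ (R.d - 1) : Uq R) ⊗ₜ[ℂ] gF + gF ⊗ₜ[ℂ] 1 := Uq.lift_F _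
  rw [tensor_smul, h]
  simp [tmul, UqMod.smul_def, Module.endTensorEndAlgHom_apply]

theorem gK_tmul (x : X) (y : Y) : (gK : Uq R) • tmul x y
    = tmul ((gK : Uq R) • x) ((gK : Uq R) • y) := by
  refine (tensorEquiv X Y).injective ?_
  have h : Uq.comul R gK = (gK : Uq R) ⊗ₜ[ℂ] gK := Uq.lift_K _
  rw [tensor_smul, h]
  simp [tmul, UqMod.smul_def, Module.endTensorEndAlgHom_apply]

theorem smul_tmul_left (c : ℂ) (x : X) (y : Y) : tmul (c • x) y = c • tmul x y := by
  rw [tmul, ← TensorProduct.smul_tmul', map_smul, tmul]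

theorem smul_tmul_right (c : ℂ) (x : X) (y : Y) : tmul x (c • y) = c • tmul x y := by
  rw [tmul, TensorProduct.tmul_smul, map_smul, tmul]

end Tensor

/-! ### Lowest weight vectors in a tensor product of simple modules -/

section TensorSimple

variable {i j : ZMod R.d} {u v : ℕ} (hu : IsSimplePair i u) (hv : IsSimplePair j v)

/-- The vectors `e_i^s ⊗ e_j^t`. -/
noncomputable def tvec (s t : ℕ) : (simpleMod i u hu).tensor (simpleMod j v hv) :=
  tmul (X := simpleMod i u hu) (Y := simpleMod j v hv)
    (chainVec hu.1 (lam_eq_zero hu.2) s) (chainVec hv.1 (lam_eq_zero hv.2) t)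

theorem tvec_of_lt {s t : ℕ} (h : u < s ∨ v < t) : tvec hu hv s t = 0 := by
  rcases h with h | h
  · rw [tvec, chainVec_of_le _ _ (by omega)]
    exact zero_tmul _
  · rw [tvec, chainVec_of_le hv.1 _ (by omega)]
    exact tmul_zero _

theorem gE_tvec (s t : ℕ) : (gE : Uq R) • tvec hu hv s t
    = tvec hu hv s (t + 1) + kw (j + (t : ZMod R.d)) • tvec hu hv (s + 1) t := by
  have h := gE_tmul (X := simpleMod i u hu) (Y := simpleMod j v hv)
    (chainVec hu.1 (lam_eq_zero hu.2) s) (chainVec hv.1 (lam_eq_zero hv.2) t)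
  refine h.trans ?_
  have h1 := gE_chainVec hu.1 (lam_eq_zero hu.2) s
  have h2 := gE_chainVec hv.1 (lam_eq_zero hv.2) t
  have h3 : _ = _ := wt_chainVec hv.1 (lam_eq_zero hv.2) t
  erw [h1, h2, h3, smul_tmul_right]
  rfl

theorem gF_tvec (s t : ℕ) : (gF : Uq R) • tvec hu hv s t
    = ((kw (i + (s : ZMod R.d)))⁻¹ * lam j t) • tvec hu hv s (t - 1)
      + lam i s • tvec hu hv (s - 1) t := by
  have h := gF_tmul (X := simpleMod i u hu) (Y := simpleMod j v hv)
    (chainVec hu.1 (lam_eq_zero hu.2) s) (chainVec hv.1 (lam_eq_zero hv.2) t)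
  refine h.trans ?_
  have h1 := gF_chainVec hu.1 (lam_eq_zero hu.2) s
  have h2 := gF_chainVec hv.1 (lam_eq_zero hv.2) t
  have h3 := (wt_chainVec hu.1 (lam_eq_zero hu.2) s).K_pow (R.d - 1)
  erw [h1, h2, h3, smul_tmul_right, smul_tmul_left, smul_tmul_left, smul_smul, kw_pow_pred,
    mul_comm]
  rfl

theorem wt_tvec (s t : ℕ) : Wt R (i + j + ((s + t : ℕ) : ZMod R.d)) (tvec hu hv s t) := by
  have h := gK_tmul (X := simpleMod i u hu) (Y := simpleMod j v hv)
    (chainVec hu.1 (lam_eq_zero hu.2) s) (chainVec hv.1 (lam_eq_zero hv.2) t)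
  refine h.trans ?_
  have h1 : _ = _ := wt_chainVec hu.1 (lam_eq_zero hu.2) s
  have h2 : _ = _ := wt_chainVec hv.1 (lam_eq_zero hv.2) t
  erw [h1, h2, smul_tmul_right, smul_tmul_left, smul_smul, ← kw_add]
  have h3 : j + (t : ZMod R.d) + (i + (s : ZMod R.d)) = i + j + ((s + t : ℕ) : ZMod R.d) := by
    push_cast
    ring
  rw [h3]
  rfl

/-- The coefficient of `e_i^s ⊗ e_j^t`. -/
noncomputable def tcoord (s t : ℕ) : (simpleMod i u hu).tensor (simpleMod j v hv) →ₗ[ℂ] ℂ :=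
  LinearMap.mul' ℂ ℂ ∘ₗ TensorProduct.map
    (coord (u + 1) s ∘ₗ (chainEquiv hu.1 (lam_eq_zero hu.2)).toLinearMap)
    (coord (v + 1) t ∘ₗ (chainEquiv hv.1 (lam_eq_zero hv.2)).toLinearMap) ∘ₗ
    (tensorEquiv (simpleMod i u hu) (simpleMod j v hv)).toLinearMap

theorem tcoord_tvec (s t s' t' : ℕ) : tcoord hu hv s t (tvec hu hv s' t')
    = (if s' = s ∧ s' < u + 1 then 1 else 0) * (if t' = t ∧ t' < v + 1 then 1 else 0) := by
  rw [← coord_vec (u + 1), ← coord_vec (v + 1)]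
  rfl

/-- The vector `∑ s, b s • e_i^s ⊗ e_j^(m - s)` of degree `m`. -/
noncomputable def homog (m : ℕ) (b : ℕ → ℂ) : (simpleMod i u hu).tensor (simpleMod j v hv) :=
  ∑ s ∈ Finset.range (m + 1), b s • tvec hu hv s (m - s)

theorem tcoord_homog {m s : ℕ} (b : ℕ → ℂ) (hs : s ≤ m) (hsu : s ≤ u) (hsv : m - s ≤ v) :
    tcoord hu hv s (m - s) (homog hu hv m b) = b s := by
  rw [homog, map_sum, Finset.sum_eq_single s]
  · rw [map_smul, tcoord_tvec, if_pos (by omega), if_pos (by omega)]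
    simp
  · intro t _ ht
    rw [map_smul, tcoord_tvec, if_neg (by omega), zero_mul, smul_zero]
  · intro h
    exact absurd (Finset.mem_range.mpr (by omega)) h

theorem homog_eq_zero {m : ℕ} {b : ℕ → ℂ} (h : ∀ s ≤ m, s ≤ u → m - s ≤ v → b s = 0) :
    homog hu hv m b = 0 := by
  refine Finset.sum_eq_zero fun s hs => ?_
  by_cases h1 : s ≤ u ∧ m - s ≤ v
  · rw [h s (by have := Finset.mem_range.mp hs; omega) h1.1 h1.2, zero_smul]
  · rw [tvec_of_lt hu hv (by omega), smul_zero]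

theorem wt_homog (m : ℕ) (b : ℕ → ℂ) : Wt R (i + j + (m : ZMod R.d)) (homog hu hv m b) := by
  unfold Wt homog
  rw [Finset.smul_sum, Finset.smul_sum]
  refine Finset.sum_congr rfl fun s hs => ?_
  have h : _ = _ := wt_tvec hu hv s (m - s)
  rw [smul_comm, h, smul_comm, show s + (m - s) = m by have := Finset.mem_range.mp hs; omega]

theorem gE_homog (m : ℕ) (b : ℕ → ℂ) : (gE : Uq R) • homog hu hv m b
    = homog hu hv (m + 1) fun s => (if s ≤ m then b s else 0)
      + if 0 < s then kw (j + ((m + 1 - s : ℕ) : ZMod R.d)) * b (s - 1) else 0 := by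
  unfold homog
  simp only [add_smul, Finset.sum_add_distrib]
  rw [Finset.sum_range_succ _ (m + 1), if_neg (by omega), zero_smul, add_zero,
    Finset.sum_range_succ' (fun s => (if 0 < s then kw (j + ((m + 1 - s : ℕ) : ZMod R.d)) * b (s - 1)
      else 0) • tvec hu hv s (m + 1 - s)), if_neg (by omega), zero_smul, add_zero,
    ← Finset.sum_add_distrib, Finset.smul_sum]
  refine Finset.sum_congr rfl fun s hs => ?_
  have hs := Finset.mem_range.mp hs
  rw [smul_comm, gE_tvec, smul_add, smul_smul, if_pos (by omega), if_pos (by omega),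
    Nat.add_sub_add_right, Nat.add_sub_cancel, mul_comm (b s), show m - s + 1 = m + 1 - s by omega]

theorem gF_homog (m : ℕ) (b : ℕ → ℂ) : (gF : Uq R) • homog hu hv (m + 1) b
    = homog hu hv m fun s => (kw (i + (s : ZMod R.d)))⁻¹ * lam j (m + 1 - s) * b s
      + lam i (s + 1) * b (s + 1) := by
  unfold homog
  simp only [add_smul, Finset.sum_add_distrib, Finset.smul_sum]
  have h : ∀ s, (gF : Uq R) • b s • tvec hu hv s (m + 1 - s)
      = ((kw (i + (s : ZMod R.d)))⁻¹ * lam j (m + 1 - s) * b s) • tvec hu hv s (m + 1 - s - 1)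
        + (lam i s * b s) • tvec hu hv (s - 1) (m + 1 - s) := by
    intro s
    rw [smul_comm, gF_tvec, smul_add, smul_smul, smul_smul, mul_comm (b s), mul_comm (b s)]
  rw [Finset.sum_congr rfl fun s _ => h s, Finset.sum_add_distrib]
  congr 1
  · rw [Finset.sum_range_succ, Nat.sub_self, lam_zero, mul_zero, zero_mul, zero_smul, add_zero]
    refine Finset.sum_congr rfl fun s _ => ?_
    rw [show m + 1 - s - 1 = m - s by omega]
  · rw [Finset.sum_range_succ', lam_zero, zero_mul, zero_smul, add_zero]
    refine Finset.sum_congr rfl fun s _ => ?_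
    rw [Nat.add_sub_cancel, Nat.add_sub_add_right]

theorem gF_homog_zero (b : ℕ → ℂ) : (gF : Uq R) • homog hu hv 0 b = 0 := by
  rw [homog, Finset.sum_range_one, smul_comm, gF_tvec, lam_zero, lam_zero]
  simp

/-- The equation `F (homog (m + 1) b) = homog m c` can be solved recursively, with an arbitrary
initial coefficient, as long as the scalars `lam i` do not vanish. -/
theorem exists_gF_homog_eq {m : ℕ} (hm : m < u) (c : ℕ → ℂ) (β : ℂ) :
    ∃ b : ℕ → ℂ, b 0 = β ∧ (gF : Uq R) • homog hu hv (m + 1) b = homog hu hv m c := by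
  let b : ℕ → ℂ := fun t => Nat.rec β (fun s x =>
    (c s - (kw (i + (s : ZMod R.d)))⁻¹ * lam j (m + 1 - s) * x) / lam i (s + 1)) t
  refine ⟨b, rfl, ?_⟩
  rw [gF_homog]
  refine Finset.sum_congr rfl fun s hs => ?_
  have hl : lam i (s + 1) ≠ 0 := hu.lam_ne_zero (by omega) (by
    have := Finset.mem_range.mp hs
    omega)
  have hb : b (s + 1)
    = (c s - (kw (i + (s : ZMod R.d)))⁻¹ * lam j (m + 1 - s) * b s) / lam i (s + 1) := rfl
  congr 1
  change _ + lam i (s + 1) * b (s + 1) = c s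
  rw [hb, mul_div_cancel₀ _ hl, add_sub_cancel]

theorem exists_lowest {l : ℕ} (hlu : l ≤ u) (hlv : l ≤ v) :
    ∃ b : ℕ → ℂ, homog hu hv l b ≠ 0 ∧ (gF : Uq R) • homog hu hv l b = 0 := by
  obtain ⟨b, hb, hF⟩ : ∃ b : ℕ → ℂ, b 0 = 1 ∧ (gF : Uq R) • homog hu hv l b = 0 := by
    cases l with
    | zero => exact ⟨fun _ => 1, rfl, gF_homog_zero hu hv _⟩
    | succ l =>
      obtain ⟨b, hb, hF⟩ := exists_gF_homog_eq hu hv (m := l) (by omega) (fun _ => 0) 1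
      exact ⟨b, hb, by rw [hF]; exact homog_eq_zero hu hv fun _ _ _ _ => rfl⟩
  refine ⟨b, fun h => ?_, hF⟩
  have h1 := tcoord_homog hu hv (m := l) b (Nat.zero_le l) (Nat.zero_le u) (by omega)
  rw [h, map_zero, hb] at h1
  exact zero_ne_one h1

/-- `E` is injective in low degrees. -/
theorem homog_eq_zero_of_gE {m : ℕ} (hmu : m < u) (hmv : m < v) {b : ℕ → ℂ}
    (h : (gE : Uq R) • homog hu hv m b = 0) : homog hu hv m b = 0 := by
  rw [gE_homog] at h
  have hb : ∀ s ≤ m, b s = 0 := by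
    intro s
    induction s with
    | zero =>
      intro _
      have h1 := tcoord_homog hu hv (m := m + 1) (fun s => (if s ≤ m then b s else 0)
        + if 0 < s then kw (j + ((m + 1 - s : ℕ) : ZMod R.d)) * b (s - 1) else 0)
        (Nat.zero_le _) (Nat.zero_le u) (by omega)
      rw [h, map_zero] at h1
      simpa using h1.symm
    | succ s ih =>
      intro hs
      have h1 := tcoord_homog hu hv (m := m + 1) (s := s + 1) (fun s => (if s ≤ m then b s else 0)
        + if 0 < s then kw (j + ((m + 1 - s : ℕ) : ZMod R.d)) * b (s - 1) else 0)
        (by omega) (by omega) (by omega)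
      rw [h, map_zero] at h1
      simpa [ih (by omega), hs] using h1.symm
  exact homog_eq_zero hu hv fun s hs _ _ => hb s hs

/-- `F` is injective in high degrees. -/
theorem homog_eq_zero_of_gF {m : ℕ} (hm : u < m) {b : ℕ → ℂ}
    (h : (gF : Uq R) • homog hu hv m b = 0) : homog hu hv m b = 0 := by
  obtain ⟨m, rfl⟩ : ∃ m', m = m' + 1 := ⟨m - 1, by omega⟩
  rw [gF_homog] at h
  have rel : ∀ s ≤ u, m + 1 - s ≤ v → (lam i (s + 1) = 0 ∨ b (s + 1) = 0) → b s = 0 := by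
    intro s hs hsv h0
    have h1 := tcoord_homog hu hv (m := m) (s := s) (fun s =>
      (kw (i + (s : ZMod R.d)))⁻¹ * lam j (m + 1 - s) * b s + lam i (s + 1) * b (s + 1))
      (by omega) hs (by omega)
    rw [h, map_zero] at h1
    have h2 : lam i (s + 1) * b (s + 1) = 0 := mul_eq_zero.mpr h0
    rw [h2, add_zero] at h1
    refine (mul_eq_zero.mp h1.symm).resolve_left (mul_ne_zero (inv_ne_zero (kw_ne_zero _)) ?_)
    exact hv.lam_ne_zero (by omega) hsv
  have key : ∀ r ≤ u, m + 1 - (u - r) ≤ v → b (u - r) = 0 := by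
    intro r
    induction r with
    | zero =>
      intro _ h1
      exact rel u le_rfl h1 (Or.inl (lam_eq_zero hu.2))
    | succ r ih =>
      intro hr h1
      refine rel _ (by omega) h1 (Or.inr ?_)
      rw [show u - (r + 1) + 1 = u - r by omega]
      exact ih (by omega) (by omega)
  refine homog_eq_zero hu hv fun s _ hsu hsv => ?_
  have := key (u - s) (by omega)
  rw [show u - (u - s) = s by omega] at this
  exact this hsv

theorem exists_gE_pow_homog (m t : ℕ) (b : ℕ → ℂ) :
    ∃ b', (gE : Uq R) ^ t • homog hu hv m b = homog hu hv (m + t) b' := by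
  induction t with
  | zero => exact ⟨b, by simp⟩
  | succ t ih =>
    obtain ⟨b', hb'⟩ := ih
    exact ⟨_, by rw [pow_succ', mul_smul, hb', gE_homog, add_assoc]⟩

theorem gE_pow_homog_ne_zero {m t : ℕ} (hmu : m + t ≤ u) (hmv : m + t ≤ v) {b : ℕ → ℂ}
    (h : homog hu hv m b ≠ 0) : (gE : Uq R) ^ t • homog hu hv m b ≠ 0 := by
  induction t with
  | zero => simpa using h
  | succ t ih =>
    obtain ⟨b', hb'⟩ := exists_gE_pow_homog hu hv m t b
    intro h0
    rw [pow_succ', mul_smul, hb'] at h0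
    refine ih (by omega) (by omega) ?_
    rw [hb']
    exact homog_eq_zero_of_gE hu hv (by omega) (by omega) h0

end TensorSimple

/-! ### The summands of the tensor product -/

section Summands

variable {i j : ZMod R.d} {u v e : ℕ} (hu : IsSimplePair i u) (hv : IsSimplePair j v)
  (he : u + v = R.d - 1 + e)

include hu hv he

theorem two_mul_add : 2 * (i + j) = 1 - (e : ZMod R.d) := by
  have h : ((u + v : ℕ) : ZMod R.d) = ((R.d - 1 + e : ℕ) : ZMod R.d) := by rw [he]
  rw [Nat.cast_add, Nat.cast_add, Nat.cast_sub (Nat.pos_of_ne_zero (NeZero.ne R.d)),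
    ZMod.natCast_self, hu.2, hv.2] at h
  push_cast at h
  linear_combination -h

theorem le_of_add_eq : e ≤ u ∧ e ≤ v := by
  have h1 := hu.1
  have h2 := hv.1
  omega

theorem val_eq {l : ℕ} (hl : 2 * l < e) :
    (-2 * (i + j + (l : ZMod R.d))).val = e - 2 * l - 1 := by
  have h1 := le_of_add_eq hu hv he
  have h2 := hu.1
  have h : -2 * (i + j + (l : ZMod R.d)) = ((e - 2 * l - 1 : ℕ) : ZMod R.d) := by
    rw [Nat.sub_sub, Nat.cast_sub (by omega)]
    push_cast
    linear_combination -two_mul_add hu hv he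
  rw [h, ZMod.val_natCast, Nat.mod_eq_of_lt (by omega)]

theorem two_mul_eq_one_iff {l : ℕ} (hl : 2 * l ≤ e) :
    2 * (i + j + (l : ZMod R.d)) = 1 ↔ 2 * l = e := by
  have h1 := le_of_add_eq hu hv he
  have h2 := hu.1
  have h3 := two_mul_add hu hv he
  constructor
  · intro h
    refine natCast_inj_of_lt (R := R) (by omega) (by omega) ?_
    push_cast
    linear_combination h - h3
  · intro h
    have h4 : (e : ZMod R.d) = 2 * l := by rw [← h]; push_cast; ring
    linear_combination h3 - h4

theorem one_sub_eq {l : ℕ} (hl : l ≤ e) :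
    1 - (i + j + (l : ZMod R.d)) = i + j + ((e - l : ℕ) : ZMod R.d) := by
  rw [Nat.cast_sub hl]
  linear_combination -two_mul_add hu hv he

/-- For `l > e` the lowest weight vector of degree `l` generates a simple module. -/
theorem exists_simple_hom {l : ℕ} (hl : l ∈ Finset.Icc (e + 1) (min u v)) :
    ∃ f : simpleMod (i + j + (l : ZMod R.d)) (u + v - 2 * l) (hu.tensor hv he hl) →ₗ[Uq R]
      (simpleMod i u hu).tensor (simpleMod j v hv), Function.Injective f := by
  have hs := hu.tensor hv he hl
  obtain ⟨hl1, hl2⟩ := Finset.mem_Icc.mp hl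
  have hlu : l ≤ u := hl2.trans (min_le_left _ _)
  have hlv : l ≤ v := hl2.trans (min_le_right _ _)
  obtain ⟨b, hb, hF⟩ := exists_lowest hu hv hlu hlv
  have hw := wt_homog hu hv l b
  have hE : (gE : Uq R) ^ (u + v - 2 * l + 1) • homog hu hv l b = 0 := by
    obtain ⟨b', hb'⟩ := exists_gE_pow_homog hu hv l (u + v - 2 * l + 1) b
    have h1 := hw.F_E_pow (u + v - 2 * l + 1)
    rw [hF, smul_zero, zero_add, lam_eq_zero hs.2, zero_smul, hb'] at h1
    rw [hb']
    exact homog_eq_zero_of_gF hu hv (by omega) h1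
  obtain ⟨f, hf⟩ := exists_chain_hom hs.1 (lam_eq_zero hs.2) hw hF hE
  refine ⟨f, chain_hom_injective (fun t h0 ht => hs.lam_ne_zero h0 (by omega)) f ?_⟩
  rw [hf, pow_zero, one_smul]
  exact hb

theorem exists_chain_hom_tensor {l : ℕ} (hl : 2 * l ≤ e) (hk : 2 * (i + j + (l : ZMod R.d)) = 1) :
    ∃ f : chain (i + j + (l : ZMod R.d)) R.d le_rfl (lam_d _) →ₗ[Uq R]
      (simpleMod i u hu).tensor (simpleMod j v hv), Function.Injective f := by
  have h1 := le_of_add_eq hu hv he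
  obtain ⟨b, hb, hF⟩ := exists_lowest hu hv (l := l) (by omega) (by omega)
  obtain ⟨f, hf⟩ := exists_chain_hom le_rfl (lam_d _) (wt_homog hu hv l b) hF (gE_pow_d _)
  refine ⟨f, (chain_isUniversal hk).injective_of_ne_zero f ?_⟩
  rw [hf, Nat.sub_self, pow_zero, one_smul, pow_zero, one_smul]
  exact hb

/-- For `2 l < e` let `w` be the lowest weight vector of degree `l`. In the degrees in question `E`
is injective and `F` is surjective, so `E ^ (a + 1) w ≠ 0` and `E ^ a w = F x` for some `x`. -/
theorem exists_big_hom_tensor {l : ℕ} (hl : 2 * l < e) (hk : 2 * (i + j + (l : ZMod R.d)) ≠ 1) :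
    ∃ f : bigMod (i + j + (l : ZMod R.d)) hk →ₗ[Uq R]
      (simpleMod i u hu).tensor (simpleMod j v hv), Function.Injective f := by
  have h1 := le_of_add_eq hu hv he
  have hval := val_eq hu hv he hl
  obtain ⟨b, hb, hF⟩ := exists_lowest hu hv (l := l) (by omega) (by omega)
  obtain ⟨c, hc⟩ := exists_gE_pow_homog hu hv l (e - 2 * l - 1) b
  obtain ⟨b', -, hb'⟩ := exists_gF_homog_eq hu hv (m := l + (e - 2 * l - 1)) (by omega) c 0
  have hx := wt_homog hu hv (l + (e - 2 * l - 1) + 1) b'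
  rw [show l + (e - 2 * l - 1) + 1 = e - l by omega] at hx hb'
  rw [← one_sub_eq hu hv he (by omega)] at hx
  obtain ⟨f, hf⟩ := exists_big_hom hk hx (wt_homog hu hv l b) hF (by rw [hb', hval, hc])
  refine ⟨f, (big_isUniversal hk).injective_of_ne_zero f ?_⟩
  rw [hf, pow_one, mul_smul, hb', ← hc, ← mul_smul, ← pow_succ']
  exact gE_pow_homog_ne_zero hu hv (by omega) (by omega) hb

end Summands

/-! ### Injectivity on direct sums -/

section LowestWeights

variable {X : Type*} [AddCommGroup X] [Module ℂ X] [Module (Uq R) X] [IsScalarTower ℂ (Uq R) X]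
  {Y : Type*} [AddCommGroup Y] [Module ℂ Y] [Module (Uq R) Y] [IsScalarTower ℂ (Uq R) Y]
  {Z : Type*} [AddCommGroup Z] [Module ℂ Z] [Module (Uq R) Z] [IsScalarTower ℂ (Uq R) Z]

variable (X) in
/-- All nonzero weight vectors of `X` that are killed by `F` have their weight in `W`. -/
def LowestWeightsIn (W : Set (ZMod R.d)) : Prop :=
  ∀ y : X, y ≠ 0 → (gF : Uq R) • y = 0 → ∀ m, Wt R m y → m ∈ W

theorem coprod_injective {W W' : Set (ZMod R.d)} (hX : LowestWeightsIn X W)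
    (hY : LowestWeightsIn Y W') (hW : Disjoint W W') {f : X →ₗ[Uq R] Z} {g : Y →ₗ[Uq R] Z}
    (hf : Function.Injective f) (hg : Function.Injective g) :
    Function.Injective (f.coprod g) := by
  rw [← LinearMap.ker_eq_bot]
  by_contra hk
  obtain ⟨y, hyk, hy, hF, m, hm⟩ := exists_lowest_weight hk
  rw [LinearMap.mem_ker, LinearMap.coprod_apply] at hyk
  have hF1 : (gF : Uq R) • y.1 = 0 := congrArg Prod.fst hF
  have hF2 : (gF : Uq R) • y.2 = 0 := congrArg Prod.snd hF
  have hm1 : Wt R m y.1 := congrArg Prod.fst hm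
  have hm2 : Wt R m y.2 := congrArg Prod.snd hm
  by_cases h1 : y.1 = 0
  · rw [h1, map_zero, zero_add] at hyk
    exact hy (Prod.ext h1 (hg (by rw [hyk]; exact (map_zero g).symm)))
  by_cases h2 : y.2 = 0
  · rw [h2, map_zero, add_zero] at hyk
    exact h1 (hf (by rw [hyk, map_zero]))
  exact Set.disjoint_left.mp hW (hX _ h1 hF1 _ hm1) (hY _ h2 hF2 _ hm2)

variable {ι : Type*} [DecidableEq ι] {M : ι → UqMod R} {W : ι → Set (ZMod R.d)}

theorem lowestWeightsIn_directSum (h : ∀ l, LowestWeightsIn (M l) (W l)) :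
    LowestWeightsIn (⨁ l, M l) (⋃ l, W l) := by
  intro y hy hF m hm
  obtain ⟨l, hl⟩ : ∃ l, y l ≠ 0 := by
    by_contra! h0
    exact hy (DFinsupp.ext h0)
  have hF' : (gF : Uq R) • y l = 0 := congrArg (fun z : ⨁ l, M l => z l) hF
  have hm' : Wt R m (y l) := congrArg (fun z : ⨁ l, M l => z l) hm
  exact Set.mem_iUnion.mpr ⟨l, h l _ hl hF' m hm'⟩

/-- A sum of injective homomorphisms is injective if the weights of the vectors killed by `F` in the
summands are distinct: its kernel contains such a vector, which lies in a single summand. -/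
theorem toModule_injective (h : ∀ l, LowestWeightsIn (M l) (W l))
    (hW : ∀ l l', l ≠ l' → Disjoint (W l) (W l')) {f : ∀ l, M l →ₗ[Uq R] Z}
    (hf : ∀ l, Function.Injective (f l)) :
    Function.Injective (DirectSum.toModule (Uq R) ι Z f) := by
  rw [← LinearMap.ker_eq_bot]
  by_contra hk
  obtain ⟨y, hyk, hy, hF, m, hm⟩ := exists_lowest_weight hk
  have hF' : ∀ l, (gF : Uq R) • y l = 0 := fun l => congrArg (fun z : ⨁ l, M l => z l) hF
  have hm' : ∀ l, Wt R m (y l) := fun l => congrArg (fun z : ⨁ l, M l => z l) hm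
  obtain ⟨l, hl⟩ : ∃ l, y l ≠ 0 := by
    by_contra! h0
    exact hy (DFinsupp.ext h0)
  have hml := h l _ hl (hF' l) m (hm' l)
  have hy' : y = DirectSum.lof (Uq R) ι (fun l => M l) l (y l) := by
    refine DFinsupp.ext fun l' => ?_
    by_cases hll : l' = l
    · subst hll
      exact (DirectSum.lof_apply (Uq R) (M := fun l => M l) _ _).symm
    · have h0 : y l' = 0 := by
        by_contra h1
        exact Set.disjoint_left.mp (hW l' l hll) (h l' _ h1 (hF' l') m (hm' l')) hml
      rw [h0]
      exact (DirectSum.of_eq_of_ne (β := fun l => M l) l l' (y l) hll).symm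
  rw [LinearMap.mem_ker, hy', DirectSum.toModule_lof] at hyk
  exact hl (hf l (by rw [hyk, map_zero]))

end LowestWeights

theorem lowestWeightsIn_chain {i : ZMod R.d} {N : ℕ} (hd : N ≤ R.d) (hN : lam i N = 0)
    (hl : ∀ t, 0 < t → t < N → lam i t ≠ 0) : LowestWeightsIn (chain i N hd hN) {i} := by
  intro y hy hF m hm
  obtain ⟨c, rfl⟩ := chain_eq_of_gF_eq_zero hl hF
  have h1 : Wt R i (c • chainVec hd hN 0) := by
    have := wt_chainVec hd hN 0
    rw [Nat.cast_zero, add_zero] at this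
    exact this.smul c
  exact kw_injective (smul_left_injective ℂ hy (hm.symm.trans h1))

/-! ### The modules `projMod` -/

/-- A property of `projMod k` may be checked separately in its two cases. -/
theorem projMod_cases {p : UqMod R → Prop} (k : ZMod R.d)
    (h1 : 2 * k = 1 → p (chain k R.d le_rfl (lam_d k))) (h2 : ∀ hk : 2 * k ≠ 1, p (bigMod k hk)) :
    p (projMod k) := by
  unfold projMod
  split_ifs with hk
  · exact h1 hk
  · exact h2 hk

instance projMod_finiteDimensional (k : ZMod R.d) : FiniteDimensional ℂ (projMod k) :=
  projMod_cases (p := fun M => FiniteDimensional ℂ M) k (fun _ => inferInstance)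
    fun _ => inferInstance

open Classical in
theorem finrank_projMod (k : ZMod R.d) :
    Module.finrank ℂ (projMod k) = if 2 * k = 1 then R.d else 2 * R.d := by
  refine projMod_cases (p := fun M => Module.finrank ℂ M = if 2 * k = 1 then R.d else 2 * R.d) k
    (fun hk => ?_) fun hk => ?_
  · rw [finrank_chain, if_pos hk]
  · rw [finrank_bigMod, if_neg hk]

theorem lowestWeightsIn_projMod (k : ZMod R.d) : LowestWeightsIn (projMod k) {k, 1 - k} := by
  refine projMod_cases (p := fun M => LowestWeightsIn M {k, 1 - k}) k (fun hk => ?_) fun hk => ?_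
  · intro y hy hF m hm
    exact Or.inl (lowestWeightsIn_chain le_rfl (lam_d k)
      (fun t h0 ht => lam_ne_zero_of_two_mul_eq_one hk h0 ht) y hy hF m hm)
  · intro y hy hF m hm
    exact big_weight hk hF hy hm

theorem projMod_properties (k : ZMod R.d) : IsIndecomposable (Uq R) (projMod k) ∧
    Module.Projective (Uq R) (projMod k) ∧ Module.Injective (Uq R) (projMod k) := by
  refine projMod_cases (p := fun M => IsIndecomposable (Uq R) M ∧ Module.Projective (Uq R) M ∧
    Module.Injective (Uq R) M) k (fun hk => ?_) fun hk => ?_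
  · have h := chain_isUniversal hk
    exact ⟨h.isIndecomposable, h.projective, h.injective⟩
  · have h := big_isUniversal hk
    exact ⟨h.isIndecomposable, h.projective, h.injective⟩

/-! ### The decomposition -/

section Decomposition

variable {i j : ZMod R.d} {u v e : ℕ} (hu : IsSimplePair i u) (hv : IsSimplePair j v)
  (he : u + v = R.d - 1 + e)

include hu hv he

theorem exists_projMod_hom {l : ℕ} (hl : 2 * l ≤ e) :
    ∃ f : projMod (i + j + (l : ZMod R.d)) →ₗ[Uq R]
      (simpleMod i u hu).tensor (simpleMod j v hv), Function.Injective f := by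
  refine projMod_cases (p := fun M => ∃ f : M →ₗ[Uq R]
    (simpleMod i u hu).tensor (simpleMod j v hv), Function.Injective f) _ (fun hk => ?_) fun hk => ?_
  · exact exists_chain_hom_tensor hu hv he hl hk
  · exact exists_big_hom_tensor hu hv he
      (lt_of_le_of_ne hl fun h => hk ((two_mul_eq_one_iff hu hv he hl).mpr h)) hk

end Decomposition

theorem sum_finrank_proj (d e : ℕ) :
    ∑ l ∈ Finset.Icc 0 (e / 2), (if 2 * l = e then d else 2 * d) = (e + 1) * d := by
  have key : ∀ h, 2 * h ≤ e + 1 → ∑ l ∈ Finset.range h, (if 2 * l = e then d else 2 * d)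
      = h * (2 * d) := by
    intro h hh
    rw [Finset.sum_congr rfl fun l hl => if_neg (by have := Finset.mem_range.mp hl; omega),
      Finset.sum_const, Finset.card_range, smul_eq_mul]
  rw [show Finset.Icc 0 (e / 2) = Finset.range (e / 2 + 1) from
    Finset.ext fun l => by rw [Finset.mem_Icc, Finset.mem_range]; omega]
  rcases Nat.even_or_odd' e with ⟨h, rfl | rfl⟩
  · rw [Finset.sum_range_succ, key _ (by omega), Nat.mul_div_cancel_left _ two_pos, if_pos rfl]
    ring
  · rw [key _ (by omega), show (2 * h + 1) / 2 = h by omega]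
    ring

theorem sum_finrank_simple {u v e : ℕ} (hu : e ≤ u) (hv : e ≤ v) :
    ∑ l ∈ Finset.Icc (e + 1) (min u v), (u + v - 2 * l + 1) = (u - e) * (v - e) := by
  have key : ∀ t, e + t ≤ u → e + t ≤ v →
      ∑ l ∈ Finset.Icc (e + 1) (e + t), ((u + v - 2 * l + 1 : ℕ) : ℤ) = t * (u + v - 2 * e - t) := by
    intro t
    induction t with
    | zero => simp
    | succ t ih =>
      intro h1 h2
      rw [← add_assoc, Finset.sum_Icc_succ_top (by omega), ih (by omega) (by omega), Nat.cast_succ,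
        Nat.cast_sub (by omega)]
      push_cast
      ring
  have h := key (min u v - e) (by omega) (by omega)
  rw [show e + (min u v - e) = min u v by omega] at h
  zify [hu, hv]
  simp only [Nat.cast_succ] at h
  rw [h, Nat.cast_sub (by omega)]
  rcases le_total u v with h | h
  · rw [min_eq_left h]; ring
  · rw [min_eq_right h]; ring

end SmallQuantum

theorem theorem5p2 (R : RootDatum) (i j : ZMod R.d) (u v e : ℕ)
    (hu : IsSimplePair i u) (hv : IsSimplePair j v) (he : u + v = R.d - 1 + e) :
    Nonempty (((simpleMod i u hu).tensor (simpleMod j v hv)) ≃ₗ[Uq R]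
      (⨁ l : Finset.Icc 0 (e / 2), projMod (i + j + ((l : ℕ) : ZMod R.d))) ×
      (⨁ l : Finset.Icc (e + 1) (min u v),
        simpleMod (i + j + ((l : ℕ) : ZMod R.d)) (u + v - 2 * (l : ℕ)) (hu.tensor hv he l.2))) ∧
    ∀ l ∈ Finset.Icc 0 (e / 2),
      IsIndecomposable (Uq R) (projMod (i + j + (l : ZMod R.d))) ∧
      Module.Projective (Uq R) (projMod (i + j + (l : ZMod R.d))) ∧
      Module.Injective (Uq R) (projMod (i + j + (l : ZMod R.d))) := by
  refine ⟨?_, fun l _ => projMod_properties _⟩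
  obtain ⟨heu, hev⟩ := le_of_add_eq hu hv he
  have hud := hu.1
  have hvd := hv.1
  have hl2 : ∀ l : Finset.Icc 0 (e / 2), 2 * (l : ℕ) ≤ e := fun l => by
    have := (Finset.mem_Icc.mp l.2).2
    omega
  choose f hf using fun l : Finset.Icc 0 (e / 2) => exists_projMod_hom hu hv he (hl2 l)
  choose g hg using fun l : Finset.Icc (e + 1) (min u v) => exists_simple_hom hu hv he l.2
  have hinj : ∀ {m n : ℕ}, m < R.d → n < R.d →
      i + j + (m : ZMod R.d) = i + j + (n : ZMod R.d) → m = n := fun hm hn h =>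
    natCast_inj_of_lt hm hn (add_left_cancel h)
  -- the weights of vectors killed by `F` are `i + j + n` with `n < d`, so that `n` is determined
  have hP : ∀ l : Finset.Icc 0 (e / 2), LowestWeightsIn (projMod (i + j + ((l : ℕ) : ZMod R.d)))
      {m | ∃ n : ℕ, (n = l ∨ n = e - l) ∧ m = i + j + (n : ZMod R.d)} := by
    intro l y hy hF m hm
    rcases lowestWeightsIn_projMod _ y hy hF m hm with h | h
    · exact ⟨l, Or.inl rfl, h⟩
    · refine ⟨e - l, Or.inr rfl, ?_⟩
      rw [h, one_sub_eq hu hv he (by have := hl2 l; omega)]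
  have hM : ∀ l : Finset.Icc (e + 1) (min u v), LowestWeightsIn
      (simpleMod (i + j + ((l : ℕ) : ZMod R.d)) (u + v - 2 * (l : ℕ)) (hu.tensor hv he l.2))
      {i + j + ((l : ℕ) : ZMod R.d)} := fun l =>
    lowestWeightsIn_chain _ _ fun t h0 ht => (hu.tensor hv he l.2).lam_ne_zero h0 (by omega)
  have hfi := toModule_injective hP (fun l l' hll => by
    rw [Set.disjoint_left]
    rintro _ ⟨n, hn, rfl⟩ ⟨n', hn', h⟩
    have h1 := hl2 l
    have h2 := hl2 l'
    have := hinj (by omega) (by omega) h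
    exact hll (Subtype.ext (by omega))) hf
  have hgi := toModule_injective hM (fun l l' hll => by
    rw [Set.disjoint_singleton]
    intro h
    have h1 := (Finset.mem_Icc.mp l.2).2
    have h2 := (Finset.mem_Icc.mp l'.2).2
    exact hll (Subtype.ext (hinj (by omega) (by omega) h))) hg
  have hinjective := coprod_injective (lowestWeightsIn_directSum hP) (lowestWeightsIn_directSum hM)
    (by
      rw [Set.disjoint_left]
      intro m hm hm'
      obtain ⟨l, n, hn, rfl⟩ := Set.mem_iUnion.mp hm
      obtain ⟨l', h⟩ := Set.mem_iUnion.mp hm'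
      have h1 := hl2 l
      have h2 := Finset.mem_Icc.mp l'.2
      have := hinj (by omega) (by omega) (Set.mem_singleton_iff.mp h)
      omega) hfi hgi
  have : ∀ l : Finset.Icc (e + 1) (min u v), FiniteDimensional ℂ
      (simpleMod (i + j + ((l : ℕ) : ZMod R.d)) (u + v - 2 * (l : ℕ)) (hu.tensor hv he l.2)) :=
    fun l => chain_finiteDimensional _ _
  have : FiniteDimensional ℂ (simpleMod i u hu) := chain_finiteDimensional _ _
  have : FiniteDimensional ℂ (simpleMod j v hv) := chain_finiteDimensional _ _
  have : FiniteDimensional ℂ ((simpleMod i u hu).tensor (simpleMod j v hv)) :=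
    (tensorEquiv _ _).symm.finiteDimensional
  have hrank : Module.finrank ℂ ((⨁ l : Finset.Icc 0 (e / 2), projMod (i + j + ((l : ℕ) : ZMod R.d))) ×
      (⨁ l : Finset.Icc (e + 1) (min u v),
        simpleMod (i + j + ((l : ℕ) : ZMod R.d)) (u + v - 2 * (l : ℕ)) (hu.tensor hv he l.2)))
      = Module.finrank ℂ ((simpleMod i u hu).tensor (simpleMod j v hv)) := by
    rw [Module.finrank_prod, Module.finrank_directSum, Module.finrank_directSum,
      (tensorEquiv _ _).finrank_eq, Module.finrank_tensorProduct]
    have h1 : ∀ l : Finset.Icc 0 (e / 2), Module.finrank ℂ (projMod (i + j + ((l : ℕ) : ZMod R.d)))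
        = if 2 * (l : ℕ) = e then R.d else 2 * R.d := fun l => by
      classical
      rw [finrank_projMod]
      simp only [two_mul_eq_one_iff hu hv he (hl2 l)]
    have h2 : ∀ (k : ZMod R.d) (w : ℕ) (h : IsSimplePair k w),
        Module.finrank ℂ (simpleMod k w h) = w + 1 := fun k w h => finrank_chain _ _
    simp only [h1, h2]
    rw [Finset.sum_coe_sort (Finset.Icc 0 (e / 2)) fun l => if 2 * l = e then R.d else 2 * R.d,
      Finset.sum_coe_sort (Finset.Icc (e + 1) (min u v)) fun l => u + v - 2 * l + 1,
      sum_finrank_proj, sum_finrank_simple heu hev]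
    have hd : R.d + e = u + v + 1 := by omega
    zify [heu, hev] at hd ⊢
    linear_combination (e + 1 : ℤ) * hd
  let Φ := (DirectSum.toModule (Uq R) _ _ f).coprod (DirectSum.toModule (Uq R) _ _ g)
  have hsurjective : Function.Surjective Φ :=
    (LinearMap.injective_iff_surjective_of_finrank_eq_finrank
      (f := Φ.restrictScalars ℂ) hrank).mp hinjective
  exact ⟨(LinearEquiv.ofBijective Φ ⟨hinjective, hsurjective⟩).symm⟩
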